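/- **Notation.** Let $n\ge 1$ and let $\alpha\ge -1/n$ be a real number. For $u,v,s,t>0$ and $p\in[-\infty,\infty)$ let $M_p^{(s,t)}(u,v)=(su^p+tv^p)^{1/p}$ if $p\ne 0,-\infty$, $M_0^{(s,t)}(u,v)=u^sv^t$ and $M_{-\infty}^{(s,t)}(u,v)=\min\{u,v\}$. For $f:\mathbb R^n\to[0,\infty)$ put $\operatorname{supp} f=\{f>0\}$. Let $\mathcal C_\alpha(\mathbb R^n)$ be the class of upper semicontinuous $f:\mathbb R^n\to[0,\infty)$ with $f(x)\to0$ as $\|x\|\to\infty$ such that $\operatorname{supp} f$ is convex and of dimension $n$, and $f(\lambda x+(1-\lambda)y)\ge M_\alpha^{(\lambda,1-\lambda)}(f(x),f(y))$ for all $x,y\in\operatorname{supp} f$ and $\lambda\in[0,1]$ (for $\lambda\in\{0,1\}$ the mean is given by the same formula). For $f\in\mathcal C_\alpha(\mathbb R^n)$ the base function $\operatorname{base}_\alpha f:\mathbb R^n\to(-\infty,\infty]$ is $(1-f^\alpha)/\alpha$ for $\alpha\neq0$ and $-\log f$ for $\alpha=0$, where for $\alpha\le 0$ the value is $+\infty$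 at the zeros of $f$, and for $\alpha>0$ the formula is used on the closure of $\operatorname{supp} f$ and the value is $+\infty$ elsewhere. Thus $f=(1-\alpha\operatorname{base}_\alpha f)_+^{1/\alpha}$ (respectively $f=e^{-\operatorname{base}_0 f}$), where the right-hand side is read as $0$ where the base function is $+\infty$. Write $(\varphi\,\square\,\psi)(x)=\inf_{y+z=x}\{\varphi(y)+\psi(z)\}$ and $(\lambda\bullet\psi)(x)=\lambda\psi(x/\lambda)$ for $\lambda>0$. The functions $f\star_\alpha g$ and $\lambda\cdot_\alpha f$ are those with base functions $\operatorname{base}_\alpha f\,\square\,\operatorname{base}_\alpha g$ and $\lambda\bullet\operatorname{base}_\alpha f$. For a unit vector $u$ let $R_u$ be the reflection about $u^\perp$ and let $\tau_u\psi=(\tfrac12\bullet\psi)\,\square\,(\tfrac12\bullet(\psi\circ R_u))$. A sequence $\psi_j$ *epi-converges* to $\psi$ if for every $x$ one has $\psi(x)\le\liminf_j\psi_j(x_j)$ whenever $x_j\to x$, and $\psi(x)=\lim_j\psi_j(x_j)$ for at least one sequence $x_j\to x$; *hypo-convergence* $f_j\to f$ is defined likewise, with $f(x)\ge\limsup_j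 f_j(x_j)$ in place of the first condition. A function $g$ is a *hypo-symmetrization* $f_{\rm sym}$ of $f\in\mathcal C_\alpha(\mathbb R^n)$ if $g=(1-\alpha\varphi)_+^{1/\alpha}$ ($g=e^{-\varphi}$ if $\alpha=0$), where $\varphi:\mathbb R^n\to(-\infty,\infty]$ is convex, lower semicontinuous, coercive, not identically $+\infty$, invariant under orthogonal transformations, and is the epi-limit of $\tau_{u_m}\cdots\tau_{u_1}\operatorname{base}_\alpha f$ as $m\to\infty$ for some sequence $(u_i)$ of unit vectors. Put $p=\frac{\alpha}{n+\alpha}$ (with $p=-\infty$ if $n=1$ and $\alpha=-1$). **Theorem.** Every $f\in\mathcal C_\alpha(\mathbb R^n)$ has a hypo-symmetrization $f_{\rm sym}$, and every hypo-symmetrization of $f$ belongs to $\mathcal C_\alpha(\mathbb R^n)$. Let $F:\mathcal C_\alpha(\mathbb R^n)\to(0,\infty)$ be invariant under orthogonal transformations, that is, $F(f\circ T)=F(f)$ for all $f\in\mathcal C_\alpha(\mathbb R^n)$ and $T\in O(n)$. 1. Suppose that $F$ is lower semicontinuous with respect to hypo-convergence, that is, $F(f)\le\liminf_jF(f_j)$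 whenever $f_j,f\in\mathcal C_\alpha(\mathbb R^n)$ and $f_j$ hypo-converges to $f$, and that $F$ is $p$-convex with respect to $\alpha$-sup-convolution, that is, $$F\big(\lambda\cdot_\alpha f\star_\alpha(1-\lambda)\cdot_\alpha g\big)\le M_p^{(\lambda,1-\lambda)}\big(F(f),F(g)\big)\qquad\text{for all } f,g\in\mathcal C_\alpha(\mathbb R^n),\ \lambda\in(0,1).$$ Then $F(f)\ge F(f_{\rm sym})$ for every $f\in\mathcal C_\alpha(\mathbb R^n)$ and every hypo-symmetrization $f_{\rm sym}$ of $f$. 2. Suppose that $F$ is upper semicontinuous with respect to hypo-convergence, that is, $F(f)\ge\limsup_jF(f_j)$ whenever $f_j,f\in\mathcal C_\alpha(\mathbb R^n)$ and $f_j$ hypo-converges to $f$, and $p$-concave with respect to $\alpha$-sup-convolution, that is, the displayed inequality holds with $\ge$ in place of $\le$. Then $F(f)\le F(f_{\rm sym})$ for every $f\in\mathcal C_\alpha(\mathbb R^n)$ and every hypo-symmetrization $f_{\rm sym}$ of $f$. -/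

import Mathlib

open Filter Topology

noncomputable section

namespace HypoSym

/-- Euclidean space `ℝⁿ`. -/
abbrev E (n : ℕ) : Type := EuclideanSpace ℝ (Fin n)

/-- The weighted mean `M_p^{(s,t)}(u,v)` of positive numbers, for `p ∈ [-∞, ∞]`. -/
def mean (p : EReal) (s t u v : ℝ) : ℝ :=
  open Classical in
  if p = ⊥ then min u v
  else if p = ⊤ then max u v
  else if p = 0 then u ^ s * v ^ t
  else (s * u ^ p.toReal + t * v ^ p.toReal) ^ (1 / p.toReal)

/-- The support `{f > 0}`; no closure is taken. -/
def supp {n : ℕ} (f : E n → ℝ) : Set (E n) := {x | 0 < f x}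

/-- `α`-concavity of a function. -/
def AlphaConcave {n : ℕ} (α : ℝ) (f : E n → ℝ) : Prop :=
  Convex ℝ (supp f) ∧
    ∀ x ∈ supp f, ∀ y ∈ supp f, ∀ l ∈ Set.Icc (0 : ℝ) 1,
      mean (α : EReal) l (1 - l) (f x) (f y) ≤ f (l • x + (1 - l) • y)

/-- The class `C_α(ℝⁿ)`. -/
structure MemC {n : ℕ} (α : ℝ) (f : E n → ℝ) : Prop where
  nonneg : ∀ x, 0 ≤ f x
  alphaConcave : AlphaConcave α f
  proper : (supp f).Nonempty
  usc : UpperSemicontinuous f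
  /-- The support has dimension `n`. -/
  fullDim : affineSpan ℝ (supp f) = ⊤
  tendsto_zero : Tendsto f (cocompact (E n)) (𝓝 0)

/-- The base function: `(1 - f ^ α) / α`, or `-log f` if `α = 0`, as a lower semicontinuous convex
function with values in `(-∞, ∞]`. Off the support it is `∞`, except that for `α > 0` it takes its
limit value `1 / α` at the boundary points of the support at which `f` vanishes. -/
def base {n : ℕ} (α : ℝ) (f : E n → ℝ) (x : E n) : EReal :=
  open Classical in
  if 0 < α then
    if x ∈ closure (supp f) then (((1 - f x ^ α) / α : ℝ) : EReal) else ⊤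
  else if 0 < f x then
    if α = 0 then ((-Real.log (f x) : ℝ) : EReal) else (((1 - f x ^ α) / α : ℝ) : EReal)
  else ⊤

/-- The function `(1 - α ψ)₊ ^ (1 / α)`, or `exp (-ψ)` if `α = 0`, with value `0` where
`ψ = ∞`. -/
def ofBase {n : ℕ} (α : ℝ) (ψ : E n → EReal) (x : E n) : ℝ :=
  open Classical in
  if ψ x = ⊤ then 0
  else if α = 0 then Real.exp (-(ψ x).toReal)
  else (max (1 - α * (ψ x).toReal) 0) ^ (1 / α)

/-- Infimal convolution. -/
def infConv {n : ℕ} (φ ψ : E n → EReal) (x : E n) : EReal := ⨅ y, φ y + ψ (x - y)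

/-- Epi-multiplication by `l > 0`. -/
def epiMul {n : ℕ} (l : ℝ) (ψ : E n → EReal) (x : E n) : EReal := (l : EReal) * ψ (l⁻¹ • x)

/-- The `α`-Asplund sum `f ⋆_α g`. -/
def asplund {n : ℕ} (α : ℝ) (f g : E n → ℝ) : E n → ℝ :=
  ofBase α (infConv (base α f) (base α g))

/-- The `(α, l)`-homothety `l ·_α f`. -/
def homothety {n : ℕ} (α l : ℝ) (f : E n → ℝ) : E n → ℝ := ofBase α (epiMul l (base α f))

/-- The reflection of `x` about `u^⊥`, for a unit vector `u`. -/
def reflect {n : ℕ} (u x : E n) : E n := x - (2 * inner ℝ x u) • u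

/-- The Minkowski symmetral of a convex function. -/
def minkSym {n : ℕ} (u : E n) (ψ : E n → EReal) : E n → EReal :=
  infConv (epiMul (1 / 2) ψ) (epiMul (1 / 2) (fun x => ψ (reflect u x)))

/-- Successive Minkowski symmetrizations, in the directions `u 0, …, u (m - 1)` in this order. -/
def iterSym {n : ℕ} (u : ℕ → E n) (ψ : E n → EReal) : ℕ → E n → EReal
  | 0 => ψ
  | m + 1 => minkSym (u m) (iterSym u ψ m)

/-- Epi-convergence. -/
def EpiTendsto {n : ℕ} (ψs : ℕ → E n → EReal) (ψ : E n → EReal) : Prop :=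
  ∀ x : E n,
    (∀ xs : ℕ → E n, Tendsto xs atTop (𝓝 x) → ψ x ≤ liminf (fun j => ψs j (xs j)) atTop) ∧
    ∃ xs : ℕ → E n, Tendsto xs atTop (𝓝 x) ∧ Tendsto (fun j => ψs j (xs j)) atTop (𝓝 (ψ x))

/-- Hypo-convergence. -/
def HypoTendsto {n : ℕ} (fs : ℕ → E n → ℝ) (f : E n → ℝ) : Prop :=
  ∀ x : E n,
    (∀ xs : ℕ → E n, Tendsto xs atTop (𝓝 x) →
      limsup (fun j => (fs j (xs j) : EReal)) atTop ≤ (f x : EReal)) ∧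
    ∃ xs : ℕ → E n, Tendsto xs atTop (𝓝 x) ∧ Tendsto (fun j => fs j (xs j)) atTop (𝓝 (f x))

/-- The class of convex, coercive, proper, lower semicontinuous functions. -/
structure MemConvC {n : ℕ} (ψ : E n → EReal) : Prop where
  convex_epi : Convex ℝ {p : E n × ℝ | ψ p.1 ≤ (p.2 : EReal)}
  coercive : Tendsto ψ (cocompact (E n)) (𝓝 ⊤)
  ne_bot : ∀ x, ψ x ≠ ⊥
  dom_nonempty : ∃ x, ψ x ≠ ⊤
  lsc : LowerSemicontinuous ψ

/-- `φ` is an epi-symmetrization of `ψ`: a function in `Conv_c(ℝⁿ)`, invariant under orthogonal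
transformations, which is the epi-limit of a sequence of successive Minkowski symmetrizations of
`ψ`. -/
def IsEpiSymmetrization {n : ℕ} (ψ φ : E n → EReal) : Prop :=
  MemConvC φ ∧ (∀ (T : E n ≃ₗᵢ[ℝ] E n) (x : E n), φ (T x) = φ x) ∧
    ∃ u : ℕ → E n, (∀ i, ‖u i‖ = 1) ∧ EpiTendsto (iterSym u ψ) φ

/-- `g` is a hypo-symmetrization `f_sym` of `f`: its base function is an epi-symmetrization of the
base function of `f`. -/
def IsHypoSymmetrization {n : ℕ} (α : ℝ) (f g : E n → ℝ) : Prop :=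
  ∃ φ : E n → EReal, IsEpiSymmetrization (base α f) φ ∧ g = ofBase α φ

/-- The exponent `α / (n + α)`; it is `-∞`, its limit as `α ↓ -1`, if `n = 1` and `α = -1`. -/
def exponent (n : ℕ) (α : ℝ) : EReal :=
  open Classical in
  if (n : ℝ) + α = 0 then ⊥ else ((α / ((n : ℝ) + α) : ℝ) : EReal)

/-! Properties of a functional `F` on `C_α(ℝⁿ)`; its values at other functions are irrelevant. -/

/-- `F` takes values in `(0, ∞)`. -/
def PosOn {n : ℕ} (α : ℝ) (F : (E n → ℝ) → ℝ) : Prop := ∀ f, MemC α f → 0 < F f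

/-- `F` is invariant under orthogonal transformations. -/
def OrthInvariant {n : ℕ} (α : ℝ) (F : (E n → ℝ) → ℝ) : Prop :=
  ∀ f, MemC α f → ∀ T : E n ≃ₗᵢ[ℝ] E n, F (fun x => f (T x)) = F f

/-- `F` is lower semicontinuous with respect to hypo-convergence. -/
def HypoLSC {n : ℕ} (α : ℝ) (F : (E n → ℝ) → ℝ) : Prop :=
  ∀ (fs : ℕ → E n → ℝ) (f : E n → ℝ), (∀ j, MemC α (fs j)) → MemC α f → HypoTendsto fs f →
    (F f : EReal) ≤ liminf (fun j => (F (fs j) : EReal)) atTop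

/-- `F` is upper semicontinuous with respect to hypo-convergence. -/
def HypoUSC {n : ℕ} (α : ℝ) (F : (E n → ℝ) → ℝ) : Prop :=
  ∀ (fs : ℕ → E n → ℝ) (f : E n → ℝ), (∀ j, MemC α (fs j)) → MemC α f → HypoTendsto fs f →
    limsup (fun j => (F (fs j) : EReal)) atTop ≤ (F f : EReal)

/-- `F` is `α / (n + α)`-convex with respect to `α`-sup-convolution. -/
def SupConvConvex {n : ℕ} (α : ℝ) (F : (E n → ℝ) → ℝ) : Prop :=
  ∀ f g, MemC α f → MemC α g → ∀ l ∈ Set.Ioo (0 : ℝ) 1,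
    F (asplund α (homothety α l f) (homothety α (1 - l) g))
      ≤ mean (exponent n α) l (1 - l) (F f) (F g)

/-- `F` is `α / (n + α)`-concave with respect to `α`-sup-convolution. -/
def SupConvConcave {n : ℕ} (α : ℝ) (F : (E n → ℝ) → ℝ) : Prop :=
  ∀ f g, MemC α f → MemC α g → ∀ l ∈ Set.Ioo (0 : ℝ) 1,
    mean (exponent n α) l (1 - l) (F f) (F g)
      ≤ F (asplund α (homothety α l f) (homothety α (1 - l) g))

end HypoSym

end

/-!
Minkowski symmetrization in the direction `u` averages the convex conjugate of a function with its
reflection. The unit vectors are therefore chosen as a sequence in which every finite block of a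
dense sequence recurs infinitely often: on each sphere the successive averages of a continuous
function `f` then converge to a constant, because the minimum of the averages is nondecreasing and
would grow by a definite amount in each such block as long as the averages are not nearly constant.
Applied to conjugates truncated at a level of `ψ`, this yields a radial limit whose affine
minorants have as supremum a function `epiSym u ψ`. It lies below the lower limit of the successive
symmetrals since its minorants of smaller slope are limits of minorants of the symmetrals; it is
attained in the limit since otherwise the symmetrals would stay above a cone, and the sandwich
theorem would produce an affine minorant of `epiSym u ψ` which is too large.

The functional inequalities follow from a single symmetrization: the `α`-Asplund sum of the halves
of `f` and of its reflection has as base function the Minkowski symmetral of `base α f`, and both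
arguments of the mean agree by orthogonal invariance. A lower bound, an upper bound and a ball on
which the base function is small are preserved by symmetrization, so the symmetrals and their limit
are base functions of elements of `C_α(ℝⁿ)`, and semicontinuity passes the inequality to the limit.
-/

open scoped Pointwise

noncomputable section

namespace HypoSym

variable {n : ℕ} {φ ψ : E n → EReal}

/-! ### Reflections -/

section Reflect

variable {u : E n}

theorem reflect_eq_reflection (hu : ‖u‖ = 1) (x : E n) :
    reflect u x = (ℝ ∙ u)ᗮ.reflection x := by
  rw [Submodule.reflection_orthogonal_apply, Submodule.reflection_apply,
    Submodule.starProjection_unit_singleton ℝ hu, reflect, real_inner_comm]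
  module

/-- The reflection about `u^⊥` as a linear isometry; for a unit vector `u` it agrees with
`reflect u`. -/
def reflectIso (u : E n) : E n ≃ₗᵢ[ℝ] E n := (ℝ ∙ u)ᗮ.reflection

theorem reflectIso_apply (hu : ‖u‖ = 1) (x : E n) : reflectIso u x = reflect u x :=
  (reflect_eq_reflection hu x).symm

theorem norm_reflect (hu : ‖u‖ = 1) (x : E n) : ‖reflect u x‖ = ‖x‖ := by
  rw [← reflectIso_apply hu, LinearIsometryEquiv.norm_map]

theorem reflect_reflect (hu : ‖u‖ = 1) (x : E n) : reflect u (reflect u x) = x := by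
  rw [reflect_eq_reflection hu, reflect_eq_reflection hu, Submodule.reflection_reflection]

theorem reflect_add (u x y : E n) : reflect u (x + y) = reflect u x + reflect u y := by
  simp only [reflect, inner_add_left]
  module

theorem reflect_sub (u x y : E n) : reflect u (x - y) = reflect u x - reflect u y := by
  simp only [reflect, inner_sub_left]
  module

theorem reflect_smul (u x : E n) (c : ℝ) : reflect u (c • x) = c • reflect u x := by
  simp only [reflect, inner_smul_left, RCLike.conj_to_real]
  module

theorem norm_reflect_sub (hu : ‖u‖ = 1) (x y : E n) :
    ‖reflect u x - reflect u y‖ = ‖x - y‖ := by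
  rw [← reflect_sub, norm_reflect hu]

theorem inner_reflect_left (u x y : E n) :
    inner ℝ (reflect u x) y = inner ℝ x (reflect u y) := by
  simp only [reflect, inner_sub_left, inner_sub_right, inner_smul_left, inner_smul_right,
    RCLike.conj_to_real, real_inner_comm u y]
  ring

theorem exists_reflect_eq {x y : E n} (hxy : ‖x‖ = ‖y‖) (hne : x ≠ y) :
    ∃ u : E n, ‖u‖ = 1 ∧ reflect u x = y := by
  have hpos : ‖x - y‖ ≠ 0 := norm_ne_zero_iff.2 (sub_ne_zero.2 hne)
  have hunit : ‖‖x - y‖⁻¹ • (x - y)‖ = 1 := by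
    rw [norm_smul, norm_inv, norm_norm, inv_mul_cancel₀ hpos]
  refine ⟨‖x - y‖⁻¹ • (x - y), hunit, ?_⟩
  have hinner : 2 * inner ℝ x (x - y) = ‖x - y‖ ^ 2 := by
    rw [@norm_sub_sq_real, inner_sub_right, real_inner_self_eq_norm_sq, hxy]
    ring
  have hcoeff : 2 * (‖x - y‖⁻¹ * inner ℝ x (x - y)) * ‖x - y‖⁻¹ = 1 := by
    rw [mul_left_comm, hinner]
    field_simp
  rw [reflect, inner_smul_right, smul_smul, hcoeff, one_smul, sub_sub_cancel]

end Reflect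

/-! ### Infimal convolution and epi-multiplication on `Conv_c(ℝⁿ)` -/

theorem ne_bot_of_coe_le {a : EReal} {c : ℝ} (h : (c : EReal) ≤ a) : a ≠ ⊥ :=
  ((EReal.bot_lt_coe c).trans_le h).ne'

theorem coe_mul_le_coe_iff {l : ℝ} (hl : 0 < l) {a : EReal} {t : ℝ} :
    (l : EReal) * a ≤ t ↔ a ≤ ((l⁻¹ * t : ℝ) : EReal) := by
  induction a with
  | bot => simp only [EReal.coe_mul_bot_of_pos hl, bot_le]
  | top => simp only [EReal.coe_mul_top_of_pos hl, top_le_iff, EReal.coe_ne_top]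
  | coe a =>
    rw [← EReal.coe_mul, EReal.coe_le_coe_iff, EReal.coe_le_coe_iff, inv_mul_eq_div,
      le_div_iff₀' hl]

theorem add_le_coe_iff {a b : EReal} (ha : a ≠ ⊥) (hb : b ≠ ⊥) {t : ℝ} :
    a + b ≤ t ↔ ∃ s s' : ℝ, a ≤ s ∧ b ≤ s' ∧ s + s' = t := by
  refine ⟨fun h => ?_, ?_⟩
  · have ha' : a ≠ ⊤ := by
      rintro rfl
      simp [EReal.top_add_of_ne_bot hb] at h
    lift a to ℝ using ⟨ha', ha⟩
    refine ⟨a, t - a, le_rfl, ?_, add_sub_cancel _ _⟩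
    rw [EReal.coe_sub]
    exact EReal.le_sub_iff_add_le (.inl (EReal.coe_ne_bot a)) (.inl (EReal.coe_ne_top a)) |>.2
      (by rwa [add_comm])
  · rintro ⟨s, s', hs, hs', rfl⟩
    exact (add_le_add hs hs').trans_eq (EReal.coe_add _ _).symm

theorem lowerSemicontinuous_of_isClosed_coe {X : Type*} [TopologicalSpace X] {f : X → EReal}
    (hf : ∀ t : ℝ, IsClosed {x | f x ≤ t}) : LowerSemicontinuous f := by
  intro x y hy
  obtain ⟨t, hyt, htx⟩ := EReal.lt_iff_exists_real_btwn.1 hy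
  filter_upwards [(hf t).isOpen_compl.mem_nhds (not_le.2 htx)] with z hz
  exact hyt.trans (not_le.1 hz)

theorem isClosed_epi (hψ : LowerSemicontinuous ψ) :
    IsClosed {p : E n × ℝ | ψ p.1 ≤ (p.2 : EReal)} :=
  hψ.isClosed_epigraph.preimage (f := fun p : E n × ℝ => (p.1, (p.2 : EReal)))
    (continuous_fst.prodMk (continuous_coe_real_ereal.comp continuous_snd))

theorem tendsto_nhds_top_of_isCompact_coe {X : Type*} [TopologicalSpace X] {f : X → EReal}
    (hf : ∀ t : ℝ, IsCompact {x | f x ≤ t}) : Tendsto f (cocompact X) (𝓝 ⊤) := by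
  rw [EReal.tendsto_nhds_top_iff_real]
  intro t
  filter_upwards [(hf t).compl_mem_cocompact] with x hx using not_le.1 hx

namespace MemConvC

theorem isCompact_sublevel (hψ : MemConvC ψ) (t : ℝ) : IsCompact {x | ψ x ≤ t} := by
  have hclosed : IsClosed {x | ψ x ≤ t} := lowerSemicontinuous_iff_isClosed_preimage.1 hψ.lsc _
  obtain ⟨K, hK, hKs⟩ := mem_cocompact.1 (EReal.tendsto_nhds_top_iff_real.1 hψ.coercive t)
  refine hK.of_isClosed_subset hclosed fun x hx => ?_
  by_contra hxK
  exact absurd (show (t : EReal) < ψ x from hKs hxK) (not_lt.2 hx)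

theorem of_isCompact_sublevel (hconv : Convex ℝ {p : E n × ℝ | ψ p.1 ≤ (p.2 : EReal)})
    (hcomp : ∀ t : ℝ, IsCompact {x | ψ x ≤ t}) (hbot : ∀ x, ψ x ≠ ⊥) (hdom : ∃ x, ψ x ≠ ⊤) :
    MemConvC ψ where
  convex_epi := hconv
  coercive := tendsto_nhds_top_of_isCompact_coe hcomp
  ne_bot := hbot
  dom_nonempty := hdom
  lsc := lowerSemicontinuous_of_isClosed_coe fun t => (hcomp t).isClosed

theorem exists_le_coe (hψ : MemConvC ψ) : ∃ (x : E n) (t : ℝ), ψ x ≤ t := by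
  obtain ⟨x, hx⟩ := hψ.dom_nonempty
  exact ⟨x, (ψ x).toReal, EReal.le_coe_toReal hx⟩

theorem exists_forall_le (hψ : MemConvC ψ) : ∃ x₀, ∀ x, ψ x₀ ≤ ψ x := by
  obtain ⟨x₁, t, hx₁⟩ := hψ.exists_le_coe
  obtain ⟨x₀, hx₀, hmin⟩ := (hψ.lsc.lowerSemicontinuousOn _).exists_isMinOn
    ⟨x₁, hx₁⟩ (hψ.isCompact_sublevel t)
  refine ⟨x₀, fun x => ?_⟩
  by_cases hx : ψ x ≤ t
  · exact hmin hx
  · exact le_trans hx₀ (not_le.1 hx).le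

theorem exists_coe_le (hψ : MemConvC ψ) : ∃ c : ℝ, ∀ x, (c : EReal) ≤ ψ x := by
  obtain ⟨x₀, hmin⟩ := hψ.exists_forall_le
  exact ⟨(ψ x₀).toReal, fun x => (EReal.coe_toReal_le (hψ.ne_bot x₀)).trans (hmin x)⟩

theorem exists_infConv_eq (hφ : MemConvC φ) (hψ : MemConvC ψ) (x : E n) :
    ∃ y, infConv φ ψ x = φ y + ψ (x - y) := by
  by_cases htop : ∀ y, φ y + ψ (x - y) = ⊤
  · exact ⟨0, by rw [htop, infConv, iInf_eq_top]; exact htop⟩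
  push Not at htop
  obtain ⟨y₁, hy₁⟩ := htop
  obtain ⟨c, hc⟩ := hψ.exists_coe_le
  set t : ℝ := (φ y₁ + ψ (x - y₁)).toReal
  have hsub : ∀ y, φ y + ψ (x - y) ≤ t → φ y ≤ ((t - c : ℝ) : EReal) := by
    intro y hy
    obtain ⟨s, s', hs, hs', hst⟩ := (add_le_coe_iff (hφ.ne_bot _) (hψ.ne_bot _)).1 hy
    have := EReal.coe_le_coe_iff.1 ((hc _).trans hs')
    exact hs.trans (EReal.coe_le_coe_iff.2 (by linarith))
  have hlsc : LowerSemicontinuous fun y => φ y + ψ (x - y) :=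
    hφ.lsc.add' (hψ.lsc.comp (continuous_const.sub continuous_id)) fun y =>
      EReal.continuousAt_add (.inr (hψ.ne_bot _)) (.inl (hφ.ne_bot _))
  have hy₁t : φ y₁ + ψ (x - y₁) ≤ t := EReal.le_coe_toReal hy₁
  obtain ⟨y, -, hmin⟩ := (hlsc.lowerSemicontinuousOn _).exists_isMinOn
    ⟨y₁, hsub y₁ hy₁t⟩ (hφ.isCompact_sublevel (t - c))
  refine ⟨y, le_antisymm (iInf_le _ y) (le_iInf fun z => ?_)⟩
  by_cases hz : φ z + ψ (x - z) ≤ t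
  · exact hmin (hsub z hz)
  · exact (hmin (hsub y₁ hy₁t)).trans (hy₁t.trans (not_le.1 hz).le)

theorem infConv_le_coe_iff (hφ : MemConvC φ) (hψ : MemConvC ψ) {x : E n} {t : ℝ} :
    infConv φ ψ x ≤ t ↔
      ∃ y z : E n, ∃ s s' : ℝ, φ y ≤ s ∧ ψ z ≤ s' ∧ y + z = x ∧ s + s' = t := by
  constructor
  · obtain ⟨y, hy⟩ := exists_infConv_eq hφ hψ x
    rw [hy, add_le_coe_iff (hφ.ne_bot _) (hψ.ne_bot _)]
    rintro ⟨s, s', hs, hs', hst⟩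
    exact ⟨y, x - y, s, s', hs, hs', add_sub_cancel _ _, hst⟩
  · rintro ⟨y, z, s, s', hs, hs', rfl, rfl⟩
    refine (iInf_le _ y).trans ?_
    rw [add_sub_cancel_left, EReal.coe_add]
    exact add_le_add hs hs'

theorem isCompact_epi_inter (hψ : MemConvC ψ) (t : ℝ) :
    IsCompact {p : E n × ℝ | ψ p.1 ≤ (p.2 : EReal) ∧ p.2 ≤ t} := by
  obtain ⟨c, hc⟩ := hψ.exists_coe_le
  refine ((hψ.isCompact_sublevel t).prod (isCompact_Icc (a := c) (b := t))).of_isClosed_subset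
    ((isClosed_epi hψ.lsc).inter (isClosed_le continuous_snd continuous_const)) ?_
  rintro ⟨x, s⟩ ⟨hx, hs⟩
  exact ⟨hx.trans (EReal.coe_le_coe_iff.2 hs), EReal.coe_le_coe_iff.1 ((hc x).trans hx), hs⟩

theorem isCompact_infConv_sublevel (hφ : MemConvC φ) (hψ : MemConvC ψ) (t : ℝ) :
    IsCompact {x | infConv φ ψ x ≤ t} := by
  obtain ⟨b, hb⟩ := hφ.exists_coe_le
  obtain ⟨c, hc⟩ := hψ.exists_coe_le
  have hpairs :=
    ((hφ.isCompact_epi_inter (t - c)).prod (hψ.isCompact_epi_inter (t - b))).inter_right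
      (isClosed_eq (f := fun q : (E n × ℝ) × (E n × ℝ) => q.1.2 + q.2.2) (g := fun _ => t)
      (by fun_prop) (by fun_prop))
  convert hpairs.image (f := fun q => q.1.1 + q.2.1) (by fun_prop) using 1
  ext x
  rw [Set.mem_ofPred_eq, infConv_le_coe_iff hφ hψ]
  constructor
  · rintro ⟨y, z, s, s', hs, hs', hx, hst⟩
    have hbs := EReal.coe_le_coe_iff.1 ((hb y).trans hs)
    have hcs := EReal.coe_le_coe_iff.1 ((hc z).trans hs')
    exact ⟨((y, s), (z, s')),
      ⟨⟨⟨hs, show s ≤ t - c by linarith⟩, ⟨hs', show s' ≤ t - b by linarith⟩⟩, hst⟩, hx⟩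
  · rintro ⟨⟨⟨y, s⟩, ⟨z, s'⟩⟩, ⟨⟨⟨hs, -⟩, ⟨hs', -⟩⟩, hst⟩, hx⟩
    exact ⟨y, z, s, s', hs, hs', hx, hst⟩

theorem epi_infConv (hφ : MemConvC φ) (hψ : MemConvC ψ) :
    {p : E n × ℝ | infConv φ ψ p.1 ≤ (p.2 : EReal)} =
      {p : E n × ℝ | φ p.1 ≤ (p.2 : EReal)} + {p : E n × ℝ | ψ p.1 ≤ (p.2 : EReal)} := by
  ext ⟨x, t⟩
  simp only [Set.mem_ofPred_eq, infConv_le_coe_iff hφ hψ, Set.mem_add, Prod.exists, Prod.mk_add_mk,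
    Prod.mk.injEq]
  constructor
  · rintro ⟨y, z, s, s', hs, hs', hx, ht⟩
    exact ⟨y, s, hs, z, s', hs', hx, ht⟩
  · rintro ⟨y, s, hs, z, s', hs', hx, ht⟩
    exact ⟨y, z, s, s', hs, hs', hx, ht⟩

protected theorem infConv (hφ : MemConvC φ) (hψ : MemConvC ψ) :
    MemConvC (infConv φ ψ) := by
  refine of_isCompact_sublevel ?_ (isCompact_infConv_sublevel hφ hψ) (fun x => ?_) ?_
  · rw [epi_infConv hφ hψ]
    exact hφ.convex_epi.add hψ.convex_epi
  · obtain ⟨y, hy⟩ := exists_infConv_eq hφ hψ x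
    rw [hy]
    exact EReal.add_ne_bot_iff.2 ⟨hφ.ne_bot _, hψ.ne_bot _⟩
  · obtain ⟨y, s, hs⟩ := hφ.exists_le_coe
    obtain ⟨z, s', hs'⟩ := hψ.exists_le_coe
    exact ⟨y + z, ne_top_of_le_ne_top (EReal.coe_ne_top _)
      ((infConv_le_coe_iff hφ hψ).2 ⟨y, z, s, s', hs, hs', rfl, rfl⟩)⟩

protected theorem epiMul (hψ : MemConvC ψ) {l : ℝ} (hl : 0 < l) : MemConvC (epiMul l ψ) := by
  refine of_isCompact_sublevel ?_ (fun t => ?_) (fun x => ?_) ?_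
  · have hepi : {p : E n × ℝ | HypoSym.epiMul l ψ p.1 ≤ (p.2 : EReal)} =
        (l⁻¹ • LinearMap.id : E n × ℝ →ₗ[ℝ] E n × ℝ) ⁻¹' {p | ψ p.1 ≤ (p.2 : EReal)} :=
      Set.ext fun p => coe_mul_le_coe_iff hl
    rw [hepi]
    exact hψ.convex_epi.linear_preimage _
  · convert (hψ.isCompact_sublevel (l⁻¹ * t)).image (continuous_const_smul l) using 1
    rw [Set.image_smul, ← Set.preimage_smul_inv₀ hl.ne']
    ext x
    exact coe_mul_le_coe_iff hl
  · obtain ⟨c, hc⟩ := hψ.exists_coe_le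
    refine ne_bot_of_coe_le (c := l * c) ?_
    rw [EReal.coe_mul]
    exact mul_le_mul_of_nonneg_left (hc _) (EReal.coe_nonneg.2 hl.le)
  · obtain ⟨y, s, hs⟩ := hψ.exists_le_coe
    refine ⟨l • y, ne_top_of_le_ne_top (EReal.coe_ne_top (l * s)) ((coe_mul_le_coe_iff hl).2 ?_)⟩
    rwa [inv_smul_smul₀ hl.ne', inv_mul_cancel_left₀ hl.ne']

theorem comp_isometry (hψ : MemConvC ψ) (T : E n ≃ₗᵢ[ℝ] E n) : MemConvC fun x => ψ (T x) where
  convex_epi := hψ.convex_epi.linear_preimage (T.toLinearMap.prodMap LinearMap.id)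
  coercive := hψ.coercive.comp T.toHomeomorph.isClosedEmbedding.tendsto_cocompact
  ne_bot x := hψ.ne_bot (T x)
  dom_nonempty := by
    obtain ⟨x, hx⟩ := hψ.dom_nonempty
    exact ⟨T.symm x, by rwa [T.apply_symm_apply]⟩
  lsc := hψ.lsc.comp T.continuous

end MemConvC

/-! ### Minkowski symmetrization -/

section MinkSym

variable {u : E n}

theorem MemConvC.comp_reflect (hψ : MemConvC ψ) (hu : ‖u‖ = 1) :
    MemConvC fun x => ψ (reflect u x) := by
  simpa only [reflectIso_apply hu] using hψ.comp_isometry (reflectIso u)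

protected theorem MemConvC.minkSym (hψ : MemConvC ψ) (hu : ‖u‖ = 1) : MemConvC (minkSym u ψ) :=
  (hψ.epiMul one_half_pos).infConv ((hψ.comp_reflect hu).epiMul one_half_pos)

theorem minkSym_le (hu : ‖u‖ = 1) {a b : E n} {s s' : ℝ} (ha : ψ a ≤ s) (hb : ψ b ≤ s') :
    minkSym u ψ ((1 / 2 : ℝ) • (a + reflect u b)) ≤ (((s + s') / 2 : ℝ) : EReal) := by
  have hleft : epiMul (1 / 2) ψ ((1 / 2 : ℝ) • a) ≤ ((s / 2 : ℝ) : EReal) := by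
    rw [epiMul, inv_smul_smul₀ one_half_pos.ne', coe_mul_le_coe_iff one_half_pos]
    convert ha using 2
    ring
  have hright : epiMul (1 / 2) (fun x => ψ (reflect u x))
      ((1 / 2 : ℝ) • (a + reflect u b) - (1 / 2 : ℝ) • a) ≤ ((s' / 2 : ℝ) : EReal) := by
    rw [epiMul, ← smul_sub, add_sub_cancel_left, inv_smul_smul₀ one_half_pos.ne',
      reflect_reflect hu, coe_mul_le_coe_iff one_half_pos]
    convert hb using 2
    ring
  refine (iInf_le _ ((1 / 2 : ℝ) • a)).trans ((add_le_add hleft hright).trans_eq ?_)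
  rw [← EReal.coe_add, add_div]

theorem coe_le_minkSym (hu : ‖u‖ = 1) {f g : E n → ℝ} (hf : ∀ a, (f a : EReal) ≤ ψ a)
    (hg : ∀ b, (g b : EReal) ≤ ψ b) {x : E n} {t : ℝ}
    (ht : ∀ a b, x = (1 / 2 : ℝ) • (a + reflect u b) → t ≤ (f a + g b) / 2) :
    (t : EReal) ≤ minkSym u ψ x := by
  have hhalf : (0 : EReal) ≤ ((1 / 2 : ℝ) : EReal) := EReal.coe_nonneg.2 one_half_pos.le
  refine le_iInf fun y => ?_
  set a := (1 / 2 : ℝ)⁻¹ • y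
  set b := reflect u ((1 / 2 : ℝ)⁻¹ • (x - y))
  have hx : x = (1 / 2 : ℝ) • (a + reflect u b) := by
    simp only [a, b, reflect_reflect hu]
    module
  calc (t : EReal) ≤ (((1 / 2) * f a + (1 / 2) * g b : ℝ) : EReal) :=
        EReal.coe_le_coe_iff.2 ((ht a b hx).trans_eq (by ring))
    _ = ((1 / 2 : ℝ) : EReal) * f a + ((1 / 2 : ℝ) : EReal) * g b := by
        rw [EReal.coe_add, EReal.coe_mul, EReal.coe_mul]
    _ ≤ ((1 / 2 : ℝ) : EReal) * ψ a + ((1 / 2 : ℝ) : EReal) * ψ b :=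
        add_le_add (mul_le_mul_of_nonneg_left (hf a) hhalf)
          (mul_le_mul_of_nonneg_left (hg b) hhalf)

protected theorem MemConvC.iterSym (hψ : MemConvC ψ) {u : ℕ → E n} (hu : ∀ i, ‖u i‖ = 1) (m : ℕ) :
    MemConvC (iterSym u ψ m) := by
  induction m with
  | zero => exact hψ
  | succ m ih => exact ih.minkSym (hu m)

theorem coe_le_iterSym {c : ℝ} (hc : ∀ x, (c : EReal) ≤ ψ x) {u : ℕ → E n}
    (hu : ∀ i, ‖u i‖ = 1) (m : ℕ) (x : E n) : (c : EReal) ≤ iterSym u ψ m x := by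
  induction m generalizing x with
  | zero => exact hc x
  | succ m ih =>
    exact coe_le_minkSym (hu m) (f := fun _ => c) (g := fun _ => c) ih ih fun _ _ _ => by linarith

end MinkSym

/-! ### Averages over reflections -/

/-- Successive averages of a real function with its reflections in the directions
`u 0, …, u (m - 1)`. Minkowski symmetrizations act on convex conjugates in this way. -/
def iterAvg (u : ℕ → E n) (f : E n → ℝ) : ℕ → E n → ℝ
  | 0 => f
  | m + 1 => fun y => (iterAvg u f m y + iterAvg u f m (reflect (u m) y)) / 2

section IterAvg

variable {u : ℕ → E n} {f : E n → ℝ}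

theorem iterAvg_add (u : ℕ → E n) (f : E n → ℝ) (k m : ℕ) :
    iterAvg u f (k + m) = iterAvg (fun i => u (k + i)) (iterAvg u f k) m := by
  induction m with
  | zero => rfl
  | succ m ih => funext y; simp only [Nat.add_eq, iterAvg, ih]

theorem iterAvg_induction {P : (E n → ℝ) → Prop} (hu : ∀ i, ‖u i‖ = 1) (hf : P f)
    (havg : ∀ (v : E n) (g : E n → ℝ), ‖v‖ = 1 → P g → P fun y => (g y + g (reflect v y)) / 2)
    (m : ℕ) : P (iterAvg u f m) := by
  induction m with
  | zero => exact hf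
  | succ m ih => exact havg (u m) _ (hu m) ih

theorem iterAvg_zero_right (u : ℕ → E n) (f : E n → ℝ) (m : ℕ) : iterAvg u f m 0 = f 0 := by
  induction m with
  | zero => rfl
  | succ m ih => simp [iterAvg, reflect, ih]

theorem iterAvg_le (hu : ∀ i, ‖u i‖ = 1) {s C : ℝ} (hf : ∀ y, ‖y‖ = s → f y ≤ C) (m : ℕ) :
    ∀ y, ‖y‖ = s → iterAvg u f m y ≤ C :=
  iterAvg_induction (P := fun g => ∀ y, ‖y‖ = s → g y ≤ C) hu hf
    (fun v g hv hg y hy => by linarith [hg y hy, hg (reflect v y) ((norm_reflect hv y).trans hy)]) m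

theorem le_iterAvg (hu : ∀ i, ‖u i‖ = 1) {s c : ℝ} (hf : ∀ y, ‖y‖ = s → c ≤ f y) (m : ℕ) :
    ∀ y, ‖y‖ = s → c ≤ iterAvg u f m y :=
  iterAvg_induction (P := fun g => ∀ y, ‖y‖ = s → c ≤ g y) hu hf
    (fun v g hv hg y hy => by linarith [hg y hy, hg (reflect v y) ((norm_reflect hv y).trans hy)]) m

theorem abs_iterAvg_sub_le (hu : ∀ i, ‖u i‖ = 1) {s δ ε : ℝ}
    (hf : ∀ y w, ‖y‖ = s → ‖w‖ = s → ‖y - w‖ < δ → |f y - f w| ≤ ε) (m : ℕ) :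
    ∀ y w, ‖y‖ = s → ‖w‖ = s → ‖y - w‖ < δ → |iterAvg u f m y - iterAvg u f m w| ≤ ε := by
  refine iterAvg_induction
    (P := fun g => ∀ y w, ‖y‖ = s → ‖w‖ = s → ‖y - w‖ < δ → |g y - g w| ≤ ε) hu hf ?_ m
  intro v g hv hg y w hy hw hyw
  have hdirect := abs_le.1 (hg y w hy hw hyw)
  have hrefl := abs_le.1 (hg (reflect v y) (reflect v w) ((norm_reflect hv y).trans hy)
    ((norm_reflect hv w).trans hw) (by rwa [norm_reflect_sub hv]))
  exact abs_le.2 ⟨by linarith, by linarith⟩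

theorem lipschitzWith_iterAvg (hu : ∀ i, ‖u i‖ = 1) {K : NNReal} (hf : LipschitzWith K f) (m : ℕ) :
    LipschitzWith K (iterAvg u f m) := by
  refine iterAvg_induction hu hf (fun v g hv hg => LipschitzWith.of_le_add_mul K fun y w => ?_) m
  have hdirect := hg.le_add_mul y w
  have hrefl := hg.le_add_mul (reflect v y) (reflect v w)
  rw [dist_eq_norm, norm_reflect_sub hv, ← dist_eq_norm] at hrefl
  linarith

theorem convexOn_iterAvg (hu : ∀ i, ‖u i‖ = 1) (hf : ConvexOn ℝ Set.univ f) (m : ℕ) :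
    ConvexOn ℝ Set.univ (iterAvg u f m) := by
  refine iterAvg_induction hu hf (fun v g _ hg => ⟨convex_univ, fun y _ w _ a b ha hb hab => ?_⟩) m
  have hdirect := hg.2 (Set.mem_univ y) (Set.mem_univ w) ha hb hab
  have hrefl := hg.2 (Set.mem_univ (reflect v y)) (Set.mem_univ (reflect v w)) ha hb hab
  simp only [reflect_add, reflect_smul, smul_eq_mul] at hdirect hrefl ⊢
  linarith

/-- A value of `f` at one orbit point has weight at least `2⁻ᵐ` in the average. -/
theorem sub_le_two_pow_mul_iterAvg_sub (hu : ∀ i, ‖u i‖ = 1) {s c a : ℝ}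
    (hf : ∀ y, ‖y‖ = s → c ≤ f y) {m : ℕ} {y : E n} (hy : ‖y‖ = s)
    (hreach : a ≤ f y ∨ ∃ i < m, a ≤ f (reflect (u i) y)) :
    a - c ≤ 2 ^ m * (iterAvg u f m y - c) := by
  have hpow : ∀ k : ℕ, (0 : ℝ) < 2 ^ k := fun k => by positivity
  have hdirect : ∀ k (w : E n), ‖w‖ = s → a ≤ f w → a - c ≤ 2 ^ k * (iterAvg u f k w - c) := by
    intro k
    induction k with
    | zero => intro w _ hw; simpa [iterAvg] using hw
    | succ k ih =>
      intro w hws hw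
      have hrefl := mul_nonneg (hpow k).le (sub_nonneg.2
        (le_iterAvg hu hf k _ ((norm_reflect (hu k) w).trans hws)))
      have := ih w hws hw
      rw [pow_succ, iterAvg]
      linarith
  rcases hreach with hya | ⟨i, him, hia⟩
  · exact hdirect m y hy hya
  · induction m, him using Nat.le_induction with
    | base =>
      have hself := mul_nonneg (hpow i).le (sub_nonneg.2 (le_iterAvg hu hf i y hy))
      have := hdirect i _ ((norm_reflect (hu i) y).trans hy) hia
      rw [Nat.succ_eq_add_one, pow_succ, iterAvg]
      linarith
    | succ k _ ih =>
      have hrefl := mul_nonneg (hpow k).le (sub_nonneg.2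
        (le_iterAvg hu hf k _ ((norm_reflect (hu k) y).trans hy)))
      rw [pow_succ, iterAvg]
      linarith

end IterAvg

/-! ### Recurrent sequences of directions -/

/-- Infinitely often a block of bounded length of the sequence contains, for any two points of a
given sphere, a reflection that moves the first one close to the second one. -/
structure IsRecurrent (u : ℕ → E n) : Prop where
  norm_eq_one : ∀ i, ‖u i‖ = 1
  frequently_reach : ∀ s δ : ℝ, 0 < δ → ∃ M : ℕ, ∃ᶠ m in atTop, ∀ y w : E n, ‖y‖ = s → ‖w‖ = s →
    ‖y - w‖ < δ ∨ ∃ i < M, ‖reflect (u (m + i)) y - w‖ < δ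

theorem norm_reflect_sub_reflect_le {u v : E n} (hu : ‖u‖ = 1) (hv : ‖v‖ = 1) (y : E n) :
    ‖reflect u y - reflect v y‖ ≤ 4 * ‖y‖ * ‖u - v‖ := by
  have hsplit : reflect u y - reflect v y =
      (-2 : ℝ) • ((inner ℝ y (u - v)) • u + (inner ℝ y v) • (u - v)) := by
    simp only [reflect, inner_sub_right]
    module
  have hinner : |inner ℝ y (u - v)| ≤ ‖y‖ * ‖u - v‖ := abs_real_inner_le_norm _ _
  have hinner' : |inner ℝ y v| ≤ ‖y‖ := by simpa [hv] using abs_real_inner_le_norm y v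
  calc ‖reflect u y - reflect v y‖
      ≤ 2 * (|inner ℝ y (u - v)| * ‖u‖ + |inner ℝ y v| * ‖u - v‖) := by
        rw [hsplit, norm_smul, Real.norm_eq_abs, abs_neg, abs_two]
        gcongr
        refine (norm_add_le _ _).trans_eq ?_
        rw [norm_smul, norm_smul, Real.norm_eq_abs, Real.norm_eq_abs]
    _ ≤ 2 * (‖y‖ * ‖u - v‖ * 1 + ‖y‖ * ‖u - v‖) := by rw [hu]; gcongr
    _ = 4 * ‖y‖ * ‖u - v‖ := by ring

theorem exists_reach_of_dense {d : ℕ → Metric.sphere (0 : E n) 1} (hd : DenseRange d) (s : ℝ)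
    {δ : ℝ} (hδ : 0 < δ) :
    ∃ M : ℕ, ∀ y w : E n, ‖y‖ = s → ‖w‖ = s →
      y = w ∨ ∃ i < M, ‖reflect (d i : E n) y - w‖ < δ := by
  have hη : 0 < δ / (4 * |s| + 1) := by positivity
  obtain ⟨t, ht⟩ := isCompact_univ.elim_finite_subcover
    (fun i => Metric.ball (d i) (δ / (4 * |s| + 1))) (fun _ => Metric.isOpen_ball) fun v _ => by
      obtain ⟨i, hi⟩ := hd.exists_dist_lt v hη
      exact Set.mem_iUnion.2 ⟨i, hi⟩
  refine ⟨t.sup id + 1, fun y w hy hw => or_iff_not_imp_left.2 fun hne => ?_⟩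
  obtain ⟨v, hv, rfl⟩ := exists_reflect_eq (hy.trans hw.symm) hne
  obtain ⟨i, hit, hi⟩ := Set.mem_iUnion₂.1 (ht (Set.mem_univ ⟨v, mem_sphere_zero_iff_norm.2 hv⟩))
  refine ⟨i, Nat.lt_succ_of_le (Finset.le_sup (f := id) hit), ?_⟩
  have hclose : ‖(d i : E n) - v‖ < δ / (4 * |s| + 1) := by
    rw [← dist_eq_norm, dist_comm]; exact hi
  refine (norm_reflect_sub_reflect_le (norm_eq_of_mem_sphere (d i)) hv y).trans_lt ?_
  rw [hy]
  calc 4 * s * ‖(d i : E n) - v‖ ≤ (4 * |s| + 1) * ‖(d i : E n) - v‖ := by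
        gcongr
        linarith [le_abs_self s]
    _ < (4 * |s| + 1) * (δ / (4 * |s| + 1)) := by gcongr
    _ = δ := mul_div_cancel₀ _ (by positivity)

/-- Following each square `a ^ 2`, the sequence runs through the first `2 a + 1` members of a dense
sequence of directions. -/
theorem exists_isRecurrent (hn : 1 ≤ n) : ∃ u : ℕ → E n, IsRecurrent u := by
  have : Nonempty (Fin n) := ⟨⟨0, hn⟩⟩
  have : Nonempty (Metric.sphere (0 : E n) 1) :=
    (NormedSpace.sphere_nonempty.2 zero_le_one).to_subtype
  refine ⟨fun m => TopologicalSpace.denseSeq (Metric.sphere (0 : E n) 1) (m - m.sqrt ^ 2),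
    fun i => norm_eq_of_mem_sphere _, fun s δ hδ => ?_⟩
  obtain ⟨M, hM⟩ := exists_reach_of_dense
    (TopologicalSpace.denseRange_denseSeq (Metric.sphere (0 : E n) 1)) s hδ
  refine ⟨M, frequently_atTop.2 fun N => ⟨(N + M) ^ 2,
    (Nat.le_add_right N M).trans (Nat.le_self_pow two_ne_zero _), fun y w hy hw => ?_⟩⟩
  rcases hM y w hy hw with rfl | ⟨i, hi, hreach⟩
  · exact .inl (by simpa using hδ)
  · refine .inr ⟨i, hi, ?_⟩
    rwa [Nat.sqrt_add_eq' _ (by omega), Nat.add_sub_cancel_left]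

/-! ### The limit of the averages -/

section LimAvg

variable {u : ℕ → E n} {f : E n → ℝ}

/-- A spread of the averages over a sphere would lift their minimum by a definite amount within
one block of a recurrent sequence. -/
theorem IsRecurrent.exists_iterAvg_le (hu : IsRecurrent u) (hf : Continuous f) {s L ε : ℝ}
    (hL : IsLUB {c | ∃ m, ∀ y, ‖y‖ = s → c ≤ iterAvg u f m y} L) (hε : 0 < ε) :
    ∃ m, ∀ y, ‖y‖ = s → iterAvg u f m y ≤ L + ε := by
  obtain ⟨δ, hδ, hmod⟩ := Metric.uniformContinuousOn_iff_le.1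
    ((isCompact_sphere (0 : E n) s).uniformContinuousOn_of_continuous hf.continuousOn) (ε / 2)
    (half_pos hε)
  have hmod' : ∀ m (y w : E n), ‖y‖ = s → ‖w‖ = s → ‖y - w‖ < δ →
      |iterAvg u f m y - iterAvg u f m w| ≤ ε / 2 := fun m =>
    abs_iterAvg_sub_le hu.norm_eq_one (fun y w hy hw hyw => by
      rw [← Real.dist_eq]
      exact hmod y (by simpa using hy) w (by simpa using hw) (by rw [dist_eq_norm]; exact hyw.le)) m
  obtain ⟨M, hM⟩ := hu.frequently_reach s δ hδ
  obtain ⟨c, ⟨m₀, hm₀⟩, hcL⟩ := hL.exists_between_sub_self (ε := ε / 2 / 2 ^ M) (by positivity)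
  obtain ⟨m, hm, hreach⟩ := frequently_atTop.1 hM m₀
  refine ⟨m, fun w hw => ?_⟩
  by_contra! hlt
  obtain ⟨k, rfl⟩ := Nat.exists_eq_add_of_le hm
  have hlow : ∀ y, ‖y‖ = s → c ≤ iterAvg u f (m₀ + k) y := by
    rw [iterAvg_add]
    exact le_iterAvg (fun i => hu.norm_eq_one _) hm₀ k
  have hnear : ∀ y, ‖y‖ = s → ‖y - w‖ < δ → L + ε / 2 ≤ iterAvg u f (m₀ + k) y :=
    fun y hy hyw => by linarith [abs_le.1 (hmod' (m₀ + k) y w hy hw hyw)]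
  have hgain : c + (L + ε / 2 - c) / 2 ^ M ≤ L := by
    refine hL.1 ⟨m₀ + k + M, fun y hy => ?_⟩
    have hlift := sub_le_two_pow_mul_iterAvg_sub (u := fun i => u (m₀ + k + i))
      (fun i => hu.norm_eq_one _) hlow hy (m := M) (a := L + ε / 2) <|
      (hreach y w hy hw).imp (hnear y hy) fun ⟨i, hi, hiw⟩ =>
        ⟨i, hi, hnear _ ((norm_reflect (hu.norm_eq_one _) y).trans hy) hiw⟩
    rw [iterAvg_add, ← le_sub_iff_add_le', div_le_iff₀' (by positivity)]
    exact hlift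
  have hcL' : ε / 2 / 2 ^ M ≤ (L + ε / 2 - c) / 2 ^ M := by
    gcongr
    linarith [hL.1 ⟨m₀, hm₀⟩]
  linarith [hcL.1]

theorem IsRecurrent.exists_tendsto_iterAvg (hu : IsRecurrent u) (hf : Continuous f) (s : ℝ) :
    ∃ L, ∀ y, ‖y‖ = s → Tendsto (fun m => iterAvg u f m y) atTop (𝓝 L) := by
  by_cases hne : ∃ y₀ : E n, ‖y₀‖ = s
  swap
  · exact ⟨0, fun y hy => absurd ⟨y, hy⟩ hne⟩
  obtain ⟨y₀, hy₀⟩ := hne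
  obtain ⟨C, hC⟩ := (isCompact_sphere (0 : E n) s).exists_bound_of_continuousOn hf.continuousOn
  have hfC : ∀ y, ‖y‖ = s → |f y| ≤ C := fun y hy => hC y (by simpa using hy)
  obtain ⟨L, hL⟩ : ∃ L, IsLUB {c | ∃ m, ∀ y, ‖y‖ = s → c ≤ iterAvg u f m y} L := by
    refine Real.exists_isLUB ⟨-C, 0, fun y hy => (abs_le.1 (hfC y hy)).1⟩ ⟨C, ?_⟩
    rintro c ⟨m, hm⟩
    exact (hm y₀ hy₀).trans
      (iterAvg_le hu.norm_eq_one (fun y hy => (abs_le.1 (hfC y hy)).2) m y₀ hy₀)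
  refine ⟨L, fun y hy => tendsto_order.2 ⟨fun b hb => ?_, fun b hb => ?_⟩⟩
  · obtain ⟨c, ⟨m, hm⟩, hbc⟩ := (lt_isLUB_iff hL).1 hb
    filter_upwards [eventually_ge_atTop m] with k hk
    obtain ⟨j, rfl⟩ := Nat.exists_eq_add_of_le hk
    rw [iterAvg_add]
    exact hbc.trans_le (le_iterAvg (fun i => hu.norm_eq_one _) hm j y hy)
  · obtain ⟨m, hm⟩ := hu.exists_iterAvg_le hf hL (half_pos (sub_pos.2 hb))
    filter_upwards [eventually_ge_atTop m] with k hk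
    obtain ⟨j, rfl⟩ := Nat.exists_eq_add_of_le hk
    rw [iterAvg_add]
    linarith [iterAvg_le (fun i => hu.norm_eq_one (m + i)) hm j y hy]

/-- The limit of the averages of `f` along `u`. For a recurrent sequence `u` and continuous `f` it
is a radial function of the argument. -/
def limAvg (u : ℕ → E n) (f : E n → ℝ) (y : E n) : ℝ := limUnder atTop fun m => iterAvg u f m y

theorem IsRecurrent.tendsto_iterAvg (hu : IsRecurrent u) (hf : Continuous f) (y : E n) :
    Tendsto (fun m => iterAvg u f m y) atTop (𝓝 (limAvg u f y)) :=
  tendsto_nhds_limUnder <| (hu.exists_tendsto_iterAvg hf ‖y‖).imp fun _ hL => hL y rfl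

theorem IsRecurrent.limAvg_eq_of_norm_eq (hu : IsRecurrent u) (hf : Continuous f) {y w : E n}
    (h : ‖y‖ = ‖w‖) : limAvg u f y = limAvg u f w := by
  obtain ⟨L, hL⟩ := hu.exists_tendsto_iterAvg hf ‖w‖
  rw [tendsto_nhds_unique (hu.tendsto_iterAvg hf y) (hL y h),
    tendsto_nhds_unique (hu.tendsto_iterAvg hf w) (hL w rfl)]

theorem limAvg_zero (u : ℕ → E n) (f : E n → ℝ) : limAvg u f 0 = f 0 := by
  simp only [limAvg, iterAvg_zero_right]
  exact tendsto_const_nhds.limUnder_eq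

theorem IsRecurrent.le_limAvg (hu : IsRecurrent u) (hf : Continuous f) {y : E n} {c : ℝ} {k : ℕ}
    (hc : ∀ w, ‖w‖ = ‖y‖ → c ≤ iterAvg u f k w) : c ≤ limAvg u f y := by
  refine ge_of_tendsto (hu.tendsto_iterAvg hf y) ?_
  filter_upwards [eventually_ge_atTop k] with m hm
  obtain ⟨j, rfl⟩ := Nat.exists_eq_add_of_le hm
  rw [iterAvg_add]
  exact le_iterAvg (fun i => hu.norm_eq_one _) hc j y rfl

theorem IsRecurrent.limAvg_le (hu : IsRecurrent u) (hf : Continuous f) {y : E n} {C : ℝ}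
    (hC : ∀ w, ‖w‖ = ‖y‖ → f w ≤ C) : limAvg u f y ≤ C :=
  le_of_tendsto' (hu.tendsto_iterAvg hf y) fun m => iterAvg_le hu.norm_eq_one hC m y rfl

theorem IsRecurrent.tendsto_iterAvg_of_tendsto (hu : IsRecurrent u) {K : NNReal}
    (hf : LipschitzWith K f) {ms : ℕ → ℕ} (hms : Tendsto ms atTop atTop) {ys : ℕ → E n} {y : E n}
    (hys : Tendsto ys atTop (𝓝 y)) :
    Tendsto (fun k => iterAvg u f (ms k) (ys k)) atTop (𝓝 (limAvg u f y)) := by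
  refine tendsto_of_tendsto_of_dist ((hu.tendsto_iterAvg hf.continuous y).comp hms) <|
    squeeze_zero (fun _ => dist_nonneg)
      (fun k => (lipschitzWith_iterAvg hu.norm_eq_one hf (ms k)).dist_le_mul y (ys k)) ?_
  simpa using ((tendsto_const_nhds (x := y)).dist hys).const_mul (K : ℝ)

/-- A convex radial function is monotone along rays: `θ y` lies between `y` and `-y`. -/
theorem IsRecurrent.limAvg_smul_le (hu : IsRecurrent u) (hf : Continuous f)
    (hconv : ConvexOn ℝ Set.univ f) {θ : ℝ} (hθ : θ ∈ Set.Icc (0 : ℝ) 1) (y : E n) :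
    limAvg u f (θ • y) ≤ limAvg u f y := by
  have hy : θ • y = ((1 + θ) / 2) • y + ((1 - θ) / 2) • (-y) := by module
  have hbound : ∀ m, iterAvg u f m (θ • y) ≤
      (1 + θ) / 2 * iterAvg u f m y + (1 - θ) / 2 * iterAvg u f m (-y) := fun m => by
    rw [hy]
    exact (convexOn_iterAvg hu.norm_eq_one hconv m).2 (Set.mem_univ y) (Set.mem_univ (-y))
      (by linarith [hθ.1]) (by linarith [hθ.2]) (by ring)
  have hlim := le_of_tendsto_of_tendsto' (hu.tendsto_iterAvg hf (θ • y))
    (((hu.tendsto_iterAvg hf y).const_mul _).add ((hu.tendsto_iterAvg hf (-y)).const_mul _)) hbound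
  rw [hu.limAvg_eq_of_norm_eq hf (norm_neg y)] at hlim
  linarith

end LimAvg

/-! ### Affine minorants and truncated conjugates -/

/-- The affine function with gradient `y` and value `-b` at the origin lies below `ψ`. -/
def AffineMinorant (ψ : E n → EReal) (y : E n) (b : ℝ) : Prop :=
  ∀ x, ((inner ℝ x y - b : ℝ) : EReal) ≤ ψ x

theorem affineMinorant_iff {y : E n} {b : ℝ} :
    AffineMinorant ψ y b ↔ ∀ (x : E n) (τ : ℝ), ψ x ≤ τ → inner ℝ x y - τ ≤ b := by
  refine ⟨fun h x τ hτ => ?_, fun h x => EReal.le_of_forall_lt_iff_le.1 fun τ hτ => ?_⟩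
  · linarith [EReal.coe_le_coe_iff.1 ((h x).trans hτ)]
  · exact EReal.coe_le_coe_iff.2 (by linarith [h x τ hτ.le])

theorem AffineMinorant.minkSym {u z : E n} {b b' : ℝ} (hu : ‖u‖ = 1) (hb : AffineMinorant ψ z b)
    (hb' : AffineMinorant ψ (reflect u z) b') : AffineMinorant (minkSym u ψ) z ((b + b') / 2) :=
  fun x => coe_le_minkSym hu hb hb' fun a c hx => by
    rw [hx, real_inner_smul_left, inner_add_left, inner_reflect_left]
    linarith

theorem AffineMinorant.iterSym {u : ℕ → E n} (hu : ∀ i, ‖u i‖ = 1) {g : E n → ℝ} {r : ℝ}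
    (hg : ∀ z, ‖z‖ ≤ r → AffineMinorant ψ z (g z)) (m : ℕ) :
    ∀ z, ‖z‖ ≤ r → AffineMinorant (iterSym u ψ m) z (iterAvg u g m z) := by
  induction m with
  | zero => exact hg
  | succ m ih => exact fun z hz =>
      (ih z hz).minkSym (hu m) (ih _ ((norm_reflect (hu m) z).trans_le hz))

theorem exists_le_iterSym_of_attained {u : ℕ → E n} (hu : ∀ i, ‖u i‖ = 1) {g : E n → ℝ}
    (hg : ∀ y, ∃ (x : E n) (τ : ℝ), ψ x ≤ τ ∧ g y = inner ℝ x y - τ) (m : ℕ) :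
    ∀ y, ∃ (x : E n) (τ : ℝ), iterSym u ψ m x ≤ τ ∧ iterAvg u g m y = inner ℝ x y - τ := by
  induction m with
  | zero => exact hg
  | succ m ih =>
    intro y
    obtain ⟨a, s, has, hy⟩ := ih y
    obtain ⟨b, s', hbs', hy'⟩ := ih (reflect (u m) y)
    refine ⟨_, _, minkSym_le (hu m) has hbs', ?_⟩
    simp only [iterAvg, hy, hy']
    rw [real_inner_smul_left, inner_add_left, inner_reflect_left]
    ring

/-- The conjugate of `ψ` restricted to the points at which `ψ ≤ t`; the truncation makes it finite
and Lipschitz. Its value is a junk `0` if there are no such points. -/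
def truncConj (ψ : E n → EReal) (t : ℝ) (y : E n) : ℝ :=
  sSup ((fun p : E n × ℝ => inner ℝ p.1 y - p.2) '' {p | ψ p.1 ≤ (p.2 : EReal) ∧ p.2 ≤ t})

namespace MemConvC

theorem le_truncConj (hψ : MemConvC ψ) {x : E n} {τ t : ℝ} (hx : ψ x ≤ τ) (hτ : τ ≤ t) (y : E n) :
    inner ℝ x y - τ ≤ truncConj ψ t y :=
  le_csSup ((hψ.isCompact_epi_inter t).bddAbove_image (by fun_prop))
    (Set.mem_image_of_mem (fun p : E n × ℝ => inner ℝ p.1 y - p.2)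
      (show (x, τ) ∈ {p : E n × ℝ | ψ p.1 ≤ (p.2 : EReal) ∧ p.2 ≤ t} from ⟨hx, hτ⟩))

section Nonempty

variable {t : ℝ}

theorem exists_truncConj_eq (hψ : MemConvC ψ) (ht : ∃ x, ψ x ≤ t) (y : E n) :
    ∃ (x : E n) (τ : ℝ), ψ x ≤ τ ∧ τ ≤ t ∧ truncConj ψ t y = inner ℝ x y - τ := by
  obtain ⟨x₀, hx₀⟩ := ht
  obtain ⟨⟨x, τ⟩, ⟨hx, hτ⟩, h⟩ := (hψ.isCompact_epi_inter t).exists_sSup_image_eq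
    ⟨(x₀, t), hx₀, le_rfl⟩ (f := fun p => inner ℝ p.1 y - p.2) (by fun_prop)
  exact ⟨x, τ, hx, hτ, h⟩

theorem exists_lipschitzWith_truncConj (hψ : MemConvC ψ) (ht : ∃ x, ψ x ≤ t) :
    ∃ K, LipschitzWith K (truncConj ψ t) := by
  obtain ⟨R, hR⟩ := (hψ.isCompact_sublevel t).isBounded.exists_norm_le
  refine ⟨R.toNNReal, LipschitzWith.of_le_add_mul _ fun y w => ?_⟩
  obtain ⟨x, τ, hx, hτ, hy⟩ := hψ.exists_truncConj_eq ht y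
  have hxR : ‖x‖ ≤ R.toNNReal :=
    (hR x (hx.trans (EReal.coe_le_coe_iff.2 hτ))).trans (Real.le_coe_toNNReal R)
  have hinner : inner ℝ x (y - w) ≤ R.toNNReal * dist y w := by
    rw [dist_eq_norm]
    exact (real_inner_le_norm _ _).trans (by gcongr)
  rw [inner_sub_right] at hinner
  linarith [hψ.le_truncConj hx hτ w]

theorem continuous_truncConj (hψ : MemConvC ψ) (ht : ∃ x, ψ x ≤ t) :
    Continuous (truncConj ψ t) :=
  (hψ.exists_lipschitzWith_truncConj ht).elim fun _ hK => hK.continuous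

theorem convexOn_truncConj (hψ : MemConvC ψ) (ht : ∃ x, ψ x ≤ t) :
    ConvexOn ℝ Set.univ (truncConj ψ t) := by
  refine ⟨convex_univ, fun y _ w _ a b ha hb hab => ?_⟩
  obtain ⟨x, τ, hx, hτ, hyw⟩ := hψ.exists_truncConj_eq ht (a • y + b • w)
  calc truncConj ψ t (a • y + b • w)
      = a * (inner ℝ x y - τ) + b * (inner ℝ x w - τ) := by
        rw [hyw, inner_add_right, real_inner_smul_right, real_inner_smul_right]
        linear_combination τ * hab
    _ ≤ a * truncConj ψ t y + b * truncConj ψ t w :=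
        add_le_add (mul_le_mul_of_nonneg_left (hψ.le_truncConj hx hτ y) ha)
          (mul_le_mul_of_nonneg_left (hψ.le_truncConj hx hτ w) hb)

theorem iterAvg_truncConj_le (hψ : MemConvC ψ) (ht : ∃ x, ψ x ≤ t) {u : ℕ → E n}
    (hu : ∀ i, ‖u i‖ = 1) {m : ℕ} {y : E n} {b : ℝ} (hb : AffineMinorant (iterSym u ψ m) y b) :
    iterAvg u (truncConj ψ t) m y ≤ b := by
  obtain ⟨x, τ, hx, h⟩ := exists_le_iterSym_of_attained hu (fun y => by
    obtain ⟨x, τ, hx, -, h⟩ := hψ.exists_truncConj_eq ht y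
    exact ⟨x, τ, hx, h⟩) m y
  exact h.trans_le (affineMinorant_iff.1 hb x τ hx)

theorem affineMinorant_zero (hψ : MemConvC ψ) (ht : ∃ x, ψ x ≤ t) :
    AffineMinorant ψ 0 (truncConj ψ t 0) := by
  obtain ⟨x₀, hx₀⟩ := ht
  refine affineMinorant_iff.2 fun x τ hx => ?_
  have hmin := hψ.le_truncConj hx₀ le_rfl 0
  rcases le_total τ t with hτ | hτ
  · exact hψ.le_truncConj hx hτ 0
  · simp only [inner_zero_right] at hmin ⊢
    linarith

end Nonempty

end MemConvC

/-! ### The epi-symmetrization -/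

/-- The pairs `(y, b)` for which `⟨·, y⟩ - b` is an affine minorant of the limit of the successive
Minkowski symmetrizations of `ψ` along `u`. -/
def limMinorants (u : ℕ → E n) (ψ : E n → EReal) : Set (E n × ℝ) :=
  {p | ∀ t : ℝ, (∃ x, ψ x ≤ t) → limAvg u (truncConj ψ t) p.1 ≤ p.2}

/-- The epi-limit of the successive Minkowski symmetrizations of `ψ` along a recurrent sequence
`u`, as the supremum of its affine minorants. -/
def epiSym (u : ℕ → E n) (ψ : E n → EReal) (x : E n) : EReal :=
  ⨆ p ∈ limMinorants u ψ, ((inner ℝ x p.1 - p.2 : ℝ) : EReal)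

theorem epiSym_le_coe_iff {u : ℕ → E n} {x : E n} {t : ℝ} :
    epiSym u ψ x ≤ t ↔ ∀ y b, (y, b) ∈ limMinorants u ψ → inner ℝ x y - b ≤ t := by
  simp only [epiSym, iSup_le_iff, EReal.coe_le_coe_iff, Prod.forall]

theorem coe_le_epiSym {u : ℕ → E n} {y : E n} {b : ℝ} (h : (y, b) ∈ limMinorants u ψ) (x : E n) :
    ((inner ℝ x y - b : ℝ) : EReal) ≤ epiSym u ψ x :=
  le_iSup₂_of_le (y, b) h le_rfl

theorem convex_epi_epiSym (u : ℕ → E n) (ψ : E n → EReal) :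
    Convex ℝ {p : E n × ℝ | epiSym u ψ p.1 ≤ (p.2 : EReal)} := by
  intro p hp q hq a b ha hb hab
  rw [Set.mem_ofPred_eq, epiSym_le_coe_iff] at hp hq ⊢
  intro y c hyc
  have hpc := mul_le_mul_of_nonneg_left (hp y c hyc) ha
  have hqc := mul_le_mul_of_nonneg_left (hq y c hyc) hb
  simp only [Prod.fst_add, Prod.snd_add, Prod.smul_fst, Prod.smul_snd, smul_eq_mul, inner_add_left,
    real_inner_smul_left]
  linear_combination hpc + hqc + c * hab

theorem isClosed_epiSym_le (u : ℕ → E n) (ψ : E n → EReal) (t : ℝ) :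
    IsClosed {x | epiSym u ψ x ≤ t} := by
  simp only [epiSym_le_coe_iff, Set.ofPred_forall]
  exact isClosed_iInter fun y => isClosed_iInter fun b => isClosed_iInter fun _ =>
    isClosed_le (by fun_prop) continuous_const

namespace MemConvC

theorem exists_mul_norm_sub_le (hψ : MemConvC ψ) :
    ∃ ε > 0, ∃ d : ℝ, ∀ x, ((ε * ‖x‖ - d : ℝ) : EReal) ≤ ψ x := by
  obtain ⟨c, hc⟩ := hψ.exists_coe_le
  obtain ⟨x₀, v, hx₀⟩ := hψ.exists_le_coe
  obtain ⟨R, hR, hball⟩ := (hψ.isCompact_sublevel (v + 1)).isBounded.subset_closedBall_lt 0 x₀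
  refine ⟨R⁻¹, inv_pos.2 hR, R⁻¹ * ‖x₀‖ + 1 - c, fun x =>
    EReal.le_of_forall_lt_iff_le.1 fun τ hτ => EReal.coe_le_coe_iff.2 ?_⟩
  have hcτ : c ≤ τ := EReal.coe_le_coe_iff.1 ((hc x).trans hτ.le)
  have hcv : c ≤ v := EReal.coe_le_coe_iff.1 ((hc x₀).trans hx₀)
  -- Slide along the segment from `x₀` to `x` until the chord has height at most `v + 1`.
  set l : ℝ := (1 + τ - c)⁻¹
  have hpos : 0 < 1 + τ - c := by linarith
  have hl : 0 < l := inv_pos.2 hpos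
  have hl1 : l ≤ 1 := inv_le_one_of_one_le₀ (by linarith)
  have hmem : l • x + (1 - l) • x₀ ∈ {z | ψ z ≤ ((v + 1 : ℝ) : EReal)} := by
    have hchord := hψ.convex_epi (x := (x, τ)) (y := (x₀, v)) hτ.le hx₀ hl.le
      (sub_nonneg.2 hl1) (add_sub_cancel l 1)
    refine hchord.trans (EReal.coe_le_coe_iff.2 ?_)
    have hlτ : l * (τ - c) ≤ 1 := by
      rw [inv_mul_le_iff₀ hpos]
      linarith
    have hlv := mul_nonneg hl.le (sub_nonneg.2 hcv)
    simp only [Prod.snd_add, Prod.smul_snd, smul_eq_mul]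
    linarith
  have hdist : ‖x - x₀‖ ≤ R * (1 + τ - c) := by
    have hlx := mem_closedBall_iff_norm.1 (hball hmem)
    rw [show l • x + (1 - l) • x₀ - x₀ = l • (x - x₀) by module, norm_smul,
      Real.norm_of_nonneg hl.le, inv_mul_le_iff₀ hpos] at hlx
    linarith
  have hnorm : R⁻¹ * ‖x‖ ≤ R⁻¹ * ‖x₀‖ + (1 + τ - c) := by
    rw [inv_mul_le_iff₀ hR, mul_add, mul_inv_cancel_left₀ hR.ne']
    linarith [norm_sub_norm_le x x₀]
  linarith

variable {u : ℕ → E n}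

theorem limMinorants_of_mul_norm_sub_le (hψ : MemConvC ψ) (hu : IsRecurrent u) {ε d : ℝ}
    (hd : ∀ x, ((ε * ‖x‖ - d : ℝ) : EReal) ≤ ψ x) {y : E n} (hy : ‖y‖ ≤ ε) :
    (y, d) ∈ limMinorants u ψ := by
  intro t ht
  refine hu.limAvg_le (hψ.continuous_truncConj ht) fun w hw => ?_
  obtain ⟨x, τ, hx, -, heq⟩ := hψ.exists_truncConj_eq ht w
  have hτ := EReal.coe_le_coe_iff.1 ((hd x).trans hx)
  have hinner : inner ℝ x w ≤ ε * ‖x‖ := by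
    rw [mul_comm]
    exact (real_inner_le_norm _ _).trans (by gcongr; exact hw.trans_le hy)
  linarith

theorem exists_mul_norm_sub_le_epiSym (hψ : MemConvC ψ) (hu : IsRecurrent u) :
    ∃ ε > 0, ∃ d : ℝ, ∀ x, ((ε * ‖x‖ - d : ℝ) : EReal) ≤ epiSym u ψ x := by
  obtain ⟨ε, hε, d, hd⟩ := hψ.exists_mul_norm_sub_le
  refine ⟨ε, hε, d, fun x => ?_⟩
  have hnorm : ‖(ε * ‖x‖⁻¹) • x‖ ≤ ε := by
    rw [norm_smul, Real.norm_of_nonneg (by positivity), mul_assoc]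
    exact mul_le_of_le_one_right hε.le (inv_mul_le_one_of_le₀ le_rfl (norm_nonneg x))
  have hinner : inner ℝ x ((ε * ‖x‖⁻¹) • x) = ε * ‖x‖ := by
    rw [real_inner_smul_right, real_inner_self_eq_norm_mul_norm, mul_assoc, ← mul_assoc ‖x‖⁻¹,
      mul_comm ‖x‖⁻¹, mul_inv_mul_cancel]
  rw [← hinner]
  exact coe_le_epiSym (hψ.limMinorants_of_mul_norm_sub_le hu hd hnorm) x

theorem epiSym_ne_top (hψ : MemConvC ψ) (hu : IsRecurrent u) : epiSym u ψ 0 ≠ ⊤ := by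
  obtain ⟨x₀, t, hx₀⟩ := hψ.exists_le_coe
  have ht : ∃ x, ψ x ≤ t := ⟨x₀, hx₀⟩
  refine ne_top_of_le_ne_top (EReal.coe_ne_top (-truncConj ψ t 0))
    (epiSym_le_coe_iff.2 fun y b hyb => ?_)
  have hmono := hu.limAvg_smul_le (hψ.continuous_truncConj ht) (hψ.convexOn_truncConj ht)
    (θ := 0) ⟨le_rfl, zero_le_one⟩ y
  rw [zero_smul, limAvg_zero] at hmono
  rw [inner_zero_left]
  linarith [hyb t ht]

protected theorem epiSym (hψ : MemConvC ψ) (hu : IsRecurrent u) : MemConvC (epiSym u ψ) := by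
  obtain ⟨ε, hε, d, hd⟩ := hψ.exists_mul_norm_sub_le_epiSym hu
  refine of_isCompact_sublevel (convex_epi_epiSym u ψ) (fun t => ?_) (fun x => ?_)
    ⟨0, hψ.epiSym_ne_top hu⟩
  · refine (isCompact_closedBall (0 : E n) ((t + d) / ε)).of_isClosed_subset
      (isClosed_epiSym_le u ψ t) fun x hx => ?_
    have hxt := EReal.coe_le_coe_iff.1 ((hd x).trans hx)
    rw [mem_closedBall_zero_iff, le_div_iff₀' hε]
    linarith
  · exact ne_bot_of_coe_le (hd x)

theorem epiSym_isometry (hψ : MemConvC ψ) (hu : IsRecurrent u) (T : E n ≃ₗᵢ[ℝ] E n) (x : E n) :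
    epiSym u ψ (T x) = epiSym u ψ x := by
  have hle : ∀ (S : E n ≃ₗᵢ[ℝ] E n) z, epiSym u ψ (S z) ≤ epiSym u ψ z := by
    refine fun S z => iSup₂_le fun ⟨y, b⟩ hyb => ?_
    have hmem : (S.symm y, b) ∈ limMinorants u ψ := fun t ht =>
      (hu.limAvg_eq_of_norm_eq (hψ.continuous_truncConj ht) (S.symm.norm_map y)).trans_le (hyb t ht)
    convert coe_le_epiSym hmem z using 3
    rw [← S.inner_map_map z, S.apply_symm_apply]
  refine (hle T x).antisymm ?_
  simpa only [T.symm_apply_apply] using hle T.symm (T x)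

end MemConvC

theorem exists_norm_eq_inner_eq_mul (x y : E n) :
    ∃ w : E n, ‖w‖ = ‖y‖ ∧ inner ℝ x w = ‖y‖ * ‖x‖ := by
  rcases eq_or_ne x 0 with rfl | hx
  · exact ⟨y, rfl, by simp⟩
  · have hnorm := norm_ne_zero_iff.2 hx
    refine ⟨(‖y‖ * ‖x‖⁻¹) • x, ?_, ?_⟩
    · rw [norm_smul, Real.norm_of_nonneg (by positivity), inv_mul_cancel_right₀ hnorm]
    · rw [real_inner_smul_right, real_inner_self_eq_norm_mul_norm]
      field_simp

namespace MemConvC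

variable {u : ℕ → E n}

theorem mul_norm_sub_le_of_limMinorants (hψ : MemConvC ψ) (hu : IsRecurrent u) {y : E n} {b r : ℝ}
    (hyb : (y, b) ∈ limMinorants u ψ) (hr : r < ‖y‖) :
    ∃ C, ∀ (x : E n) (τ : ℝ), ψ x ≤ τ → r * ‖x‖ - τ ≤ C := by
  obtain ⟨x₀, τ₀, hx₀⟩ := hψ.exists_le_coe
  obtain ⟨M, hM⟩ := hu.frequently_reach ‖y‖ (‖y‖ - r) (sub_pos.2 hr)
  obtain ⟨m, hm⟩ := hM.exists
  set c : ℝ := -(‖x₀‖ * ‖y‖) - τ₀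
  refine ⟨2 ^ (m + M) * (b - c) + c, fun x τ hx => ?_⟩
  have ht : ∃ z, ψ z ≤ (max τ τ₀ : ℝ) :=
    ⟨x₀, hx₀.trans (EReal.coe_le_coe_iff.2 (le_max_right _ _))⟩
  set g := truncConj ψ (max τ τ₀)
  have hlow : ∀ z, ‖z‖ = ‖y‖ → c ≤ g z := fun z hz => by
    have hinner := (abs_le.1 (abs_real_inner_le_norm x₀ z)).1
    rw [hz] at hinner
    exact (sub_le_sub_right hinner τ₀).trans (hψ.le_truncConj hx₀ (le_max_right _ _) z)
  obtain ⟨w, hw, hxw⟩ := exists_norm_eq_inner_eq_mul x y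
  have hnear : ∀ z, ‖z - w‖ < ‖y‖ - r → r * ‖x‖ - τ ≤ g z := fun z hz => by
    have hinner := (abs_le.1 (abs_real_inner_le_norm x (z - w))).1
    have hle := mul_le_mul_of_nonneg_left hz.le (norm_nonneg x)
    rw [inner_sub_right, hxw] at hinner
    linarith [hψ.le_truncConj hx (le_max_left τ τ₀) z]
  have hlift : ∀ z, ‖z‖ = ‖y‖ → c + (r * ‖x‖ - τ - c) / 2 ^ (m + M) ≤ iterAvg u g (m + M) z := by
    intro z hz
    rw [← le_sub_iff_add_le', div_le_iff₀' (by positivity)]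
    exact sub_le_two_pow_mul_iterAvg_sub hu.norm_eq_one hlow hz <|
      (hm z w hz hw).imp (hnear z) fun ⟨i, hi, hiw⟩ => ⟨m + i, by omega, hnear _ hiw⟩
  have hfinal := (hu.le_limAvg (hψ.continuous_truncConj ht) hlift).trans (hyb _ ht)
  rw [← le_sub_iff_add_le', div_le_iff₀' (by positivity)] at hfinal
  linarith

/-- On a ball strictly inside the domain of the limit the truncation is immaterial: `ψ` grows
faster than `⟨·, z⟩` at infinity. -/
theorem exists_affineMinorant_truncConj (hψ : MemConvC ψ) (hu : IsRecurrent u) {y : E n} {b r : ℝ}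
    (hyb : (y, b) ∈ limMinorants u ψ) (hr0 : 0 ≤ r) (hr : r < ‖y‖) :
    ∃ t : ℝ, (∃ x, ψ x ≤ t) ∧ ∀ z, ‖z‖ ≤ r → AffineMinorant ψ z (truncConj ψ t z) := by
  obtain ⟨x₀, τ₀, hx₀⟩ := hψ.exists_le_coe
  obtain ⟨r', hrr', hr'⟩ := exists_between hr
  obtain ⟨C, hC⟩ := hψ.mul_norm_sub_le_of_limMinorants hu hyb hr'
  set t₁ : ℝ := (r * C + r' * (‖x₀‖ * r + τ₀)) / (r' - r)
  refine ⟨max τ₀ t₁, ⟨x₀, hx₀.trans (EReal.coe_le_coe_iff.2 (le_max_left _ _))⟩, fun z hz =>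
    affineMinorant_iff.2 fun x τ hx => ?_⟩
  rcases le_total τ (max τ₀ t₁) with hτ | hτ
  · exact hψ.le_truncConj hx hτ z
  refine le_trans (le_of_mul_le_mul_left ?_ (hr0.trans_lt hrr'))
    (hψ.le_truncConj hx₀ (le_max_left _ _) z)
  have hτ₁ : r * C + r' * (‖x₀‖ * r + τ₀) ≤ τ * (r' - r) :=
    (div_le_iff₀ (sub_pos.2 hrr')).1 ((le_max_right τ₀ t₁).trans hτ)
  calc r' * (inner ℝ x z - τ) ≤ r' * (‖x‖ * r - τ) := by
        gcongr
        · exact hr0.trans hrr'.le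
        · exact (real_inner_le_norm x z).trans (by gcongr)
    _ = r * (r' * ‖x‖ - τ) - τ * (r' - r) := by ring
    _ ≤ r * C - (r * C + r' * (‖x₀‖ * r + τ₀)) :=
        sub_le_sub (mul_le_mul_of_nonneg_left (hC x τ hx) hr0) hτ₁
    _ = r' * (-(‖x₀‖ * r) - τ₀) := by ring
    _ ≤ r' * (inner ℝ x₀ z - τ₀) := by
        gcongr
        · exact hr0.trans hrr'.le
        · refine le_trans ?_ (abs_le.1 (abs_real_inner_le_norm x₀ z)).1
          gcongr

theorem smul_sub_le_liminf_iterSym (hψ : MemConvC ψ) (hu : IsRecurrent u) {y : E n} {b : ℝ}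
    (hyb : (y, b) ∈ limMinorants u ψ) {θ : ℝ} (hθ0 : 0 ≤ θ) (hθ1 : θ < 1) {x : E n}
    {xs : ℕ → E n} (hxs : Tendsto xs atTop (𝓝 x)) :
    ((θ * inner ℝ x y - b : ℝ) : EReal) ≤ liminf (fun m => iterSym u ψ m (xs m)) atTop := by
  obtain ⟨t, ht, hminor⟩ : ∃ t : ℝ, (∃ x, ψ x ≤ t) ∧
      ∀ z, ‖z‖ ≤ ‖θ • y‖ → AffineMinorant ψ z (truncConj ψ t z) := by
    rcases eq_or_ne y 0 with rfl | hy
    · obtain ⟨x₀, t, hx₀⟩ := hψ.exists_le_coe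
      refine ⟨t, ⟨x₀, hx₀⟩, fun z hz => ?_⟩
      obtain rfl : z = 0 := by simpa using hz
      exact hψ.affineMinorant_zero ⟨x₀, hx₀⟩
    · refine hψ.exists_affineMinorant_truncConj hu hyb (norm_nonneg _) ?_
      rw [norm_smul, Real.norm_of_nonneg hθ0]
      exact mul_lt_of_lt_one_left (norm_pos_iff.2 hy) hθ1
  have hlim : Tendsto
      (fun m => ((inner ℝ (xs m) (θ • y) - iterAvg u (truncConj ψ t) m (θ • y) : ℝ) : EReal)) atTop
      (𝓝 ((inner ℝ x (θ • y) - limAvg u (truncConj ψ t) (θ • y) : ℝ) : EReal)) :=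
    EReal.tendsto_coe.2 ((hxs.inner tendsto_const_nhds).sub
      (hu.tendsto_iterAvg (hψ.continuous_truncConj ht) _))
  have hmono := hu.limAvg_smul_le (hψ.continuous_truncConj ht) (hψ.convexOn_truncConj ht)
    ⟨hθ0, hθ1.le⟩ y
  calc ((θ * inner ℝ x y - b : ℝ) : EReal)
      ≤ ((inner ℝ x (θ • y) - limAvg u (truncConj ψ t) (θ • y) : ℝ) : EReal) := by
        rw [real_inner_smul_right]
        exact EReal.coe_le_coe_iff.2 (by linarith [hyb t ht])
    _ = liminf (fun m => ((inner ℝ (xs m) (θ • y) -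
          iterAvg u (truncConj ψ t) m (θ • y) : ℝ) : EReal)) atTop := hlim.liminf_eq.symm
    _ ≤ liminf (fun m => iterSym u ψ m (xs m)) atTop :=
        liminf_le_liminf <| .of_forall fun m =>
          AffineMinorant.iterSym hu.norm_eq_one hminor m _ le_rfl (xs m)

theorem epiSym_le_liminf_iterSym (hψ : MemConvC ψ) (hu : IsRecurrent u) {x : E n} {xs : ℕ → E n}
    (hxs : Tendsto xs atTop (𝓝 x)) :
    epiSym u ψ x ≤ liminf (fun m => iterSym u ψ m (xs m)) atTop := by
  refine iSup₂_le fun ⟨y, b⟩ hyb => ?_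
  have hlim : Tendsto (fun θ : ℝ => ((θ * inner ℝ x y - b : ℝ) : EReal)) (𝓝[<] 1)
      (𝓝 ((1 * inner ℝ x y - b : ℝ) : EReal)) :=
    ((continuous_coe_real_ereal.comp (by fun_prop)).tendsto (1 : ℝ)).mono_left nhdsWithin_le_nhds
  rw [one_mul] at hlim
  refine le_of_tendsto hlim ?_
  filter_upwards [Ioo_mem_nhdsLT zero_lt_one] with θ hθ
  exact hψ.smul_sub_le_liminf_iterSym hu hyb hθ.1.le hθ.2 hxs

end MemConvC

theorem AffineMinorant.mono {y : E n} {b c : ℝ} (h : AffineMinorant ψ y b) (hbc : b ≤ c) :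
    AffineMinorant ψ y c :=
  fun x => (EReal.coe_le_coe_iff.2 (sub_le_sub_left hbc _)).trans (h x)

/-- The sandwich theorem: a hyperplane separates the epigraph of `ψ` from the hypograph of `g`. -/
theorem exists_affineMinorant_ge (hconv : Convex ℝ {p : E n × ℝ | ψ p.1 ≤ (p.2 : EReal)})
    (hdom : ∃ (a : E n) (s : ℝ), ψ a ≤ s) {g : E n → ℝ} (hg : ConcaveOn ℝ Set.univ g)
    (hgc : Continuous g) (hle : ∀ a, (g a : EReal) ≤ ψ a) :
    ∃ y b, AffineMinorant ψ y b ∧ ∀ a, g a ≤ inner ℝ a y - b := by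
  have hdisj : Disjoint {p : E n × ℝ | p.1 ∈ Set.univ ∧ p.2 < g p.1}
      {p : E n × ℝ | ψ p.1 ≤ (p.2 : EReal)} :=
    Set.disjoint_left.2 fun p hp hψp =>
      hp.2.not_ge (EReal.coe_le_coe_iff.1 ((hle p.1).trans hψp))
  obtain ⟨f, r, hbelow, habove⟩ := geometric_hahn_banach_open hg.convex_strict_hypograph
    (by simpa using isOpen_lt continuous_snd (hgc.comp continuous_fst)) hconv hdisj
  set κ := f (0, 1)
  have hsplit : ∀ a s, f (a, s) = f (a, 0) + s * κ := fun a s => by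
    rw [← smul_eq_mul, ← map_smul, ← map_add]
    simp
  have hκ : 0 < κ := by
    obtain ⟨a, s, has⟩ := hdom
    have hlt := (hbelow (a, g a - 1) ⟨trivial, sub_one_lt _⟩).trans_le (habove (a, s) has)
    have hgs := EReal.coe_le_coe_iff.1 ((hle a).trans has)
    rw [hsplit, hsplit a s, add_lt_add_iff_left] at hlt
    exact pos_of_mul_pos_right (a := s - (g a - 1)) (by linarith) (by linarith)
  set y := (InnerProductSpace.toDual ℝ (E n)).symm (-κ⁻¹ • f.comp (.inl ℝ (E n) ℝ))
  have hval : ∀ a s, f (a, s) = κ * (s - inner ℝ a y) := fun a s => by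
    have hy : inner ℝ a y = -κ⁻¹ * f (a, 0) := by
      rw [real_inner_comm, InnerProductSpace.toDual_symm_apply]
      simp
    rw [hsplit, hy]
    field_simp
    ring
  refine ⟨y, -(r / κ), affineMinorant_iff.2 fun a s has => ?_,
    fun a => le_of_forall_lt fun s hs => ?_⟩
  · have := habove (a, s) has
    rw [hval, ← div_le_iff₀' hκ] at this
    linarith
  · have := hbelow (a, s) ⟨trivial, hs⟩
    rw [hval, ← lt_div_iff₀' hκ] at this
    linarith

theorem norm_le_of_inner_le_add {y : E n} {K D : ℝ} (hK : 0 ≤ K)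
    (h : ∀ v, inner ℝ v y ≤ K * ‖v‖ + D) : ‖y‖ ≤ K := by
  have hD : 0 ≤ D := by simpa using h 0
  by_contra! hlt
  have hpos : 0 < ‖y‖ * (‖y‖ - K) := mul_pos (hK.trans_lt hlt) (sub_pos.2 hlt)
  have hscale := h (((D + 1) / (‖y‖ * (‖y‖ - K))) • y)
  rw [real_inner_smul_left, real_inner_self_eq_norm_mul_norm, norm_smul,
    Real.norm_of_nonneg (by positivity)] at hscale
  have := div_mul_cancel₀ (D + 1) hpos.ne'
  linarith

theorem exists_affineMinorant_of_cone_le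
    (hconv : Convex ℝ {p : E n × ℝ | ψ p.1 ≤ (p.2 : EReal)})
    (hdom : ∃ (a : E n) (s : ℝ), ψ a ≤ s) {x : E n} {t K : ℝ} (hK : 0 ≤ K)
    (hcone : ∀ a, ((t - K * dist a x : ℝ) : EReal) ≤ ψ a) :
    ∃ y, ‖y‖ ≤ K ∧ AffineMinorant ψ y (inner ℝ x y - t) := by
  obtain ⟨y, b, hb, hge⟩ := exists_affineMinorant_ge hconv hdom
    ((concaveOn_const t convex_univ).sub ((convexOn_univ_dist x).smul hK)) (by fun_prop) hcone
  simp only [Pi.sub_apply, smul_eq_mul] at hge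
  refine ⟨y, norm_le_of_inner_le_add hK (D := inner ℝ x y - b - t) fun v => ?_, hb.mono ?_⟩
  · have := hge (x - v)
    rw [dist_self_sub_left, inner_sub_left] at this
    linarith
  · have := hge x
    rw [dist_self] at this
    linarith

/-! ### Epi-convergence -/

theorem exists_tendsto_of_eventually_dist_lt {X : Type*} [PseudoMetricSpace X] {S : ℕ → Set X}
    {p : X} (h : ∀ ε > 0, ∀ᶠ m in atTop, ∃ q ∈ S m, dist p q < ε) :
    ∃ qs : ℕ → X, Tendsto qs atTop (𝓝 p) ∧ ∀ᶠ m in atTop, qs m ∈ S m := by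
  have hne : ∀ᶠ m in atTop, (S m).Nonempty := (h 1 one_pos).mono fun m ⟨q, hq, _⟩ => ⟨q, hq⟩
  have hinf : Tendsto (fun m => Metric.infDist p (S m) + 1 / ((m : ℝ) + 1)) atTop (𝓝 0) := by
    rw [← add_zero 0]
    refine Tendsto.add ?_ tendsto_one_div_add_atTop_nhds_zero_nat
    refine (nhds_basis_Ioo_pos (0 : ℝ)).tendsto_right_iff.2 fun ε hε => ?_
    filter_upwards [h ε hε] with m ⟨q, hq, hpq⟩
    rw [zero_sub, zero_add]
    exact ⟨(neg_neg_of_pos hε).trans_le Metric.infDist_nonneg,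
      (Metric.infDist_le_dist_of_mem hq).trans_lt hpq⟩
  have hchoice : ∀ m, ∃ q, (S m).Nonempty →
      q ∈ S m ∧ dist p q < Metric.infDist p (S m) + 1 / ((m : ℝ) + 1) := fun m => by
    by_cases hm : (S m).Nonempty
    · obtain ⟨q, hq, hpq⟩ := (Metric.infDist_lt_iff hm).1
        (lt_add_of_pos_right (Metric.infDist p (S m)) (Nat.one_div_pos_of_nat (n := m)))
      exact ⟨q, fun _ => ⟨hq, hpq⟩⟩
    · exact ⟨p, fun hm' => absurd hm' hm⟩
  choose qs hqs using hchoice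
  refine ⟨qs, tendsto_iff_dist_tendsto_zero.2 (squeeze_zero' (.of_forall fun _ => dist_nonneg) ?_
    hinf), hne.mono fun m hm => (hqs m hm).1⟩
  filter_upwards [hne] with m hm
  rw [dist_comm]
  exact (hqs m hm).2.le

theorem epiTendsto_of_le_liminf {ψs : ℕ → E n → EReal} (hbot : ∀ x, φ x ≠ ⊥)
    (hliminf : ∀ (x : E n) (xs : ℕ → E n), Tendsto xs atTop (𝓝 x) →
      φ x ≤ liminf (fun m => ψs m (xs m)) atTop)
    (hlt : ∀ (x : E n) (t : ℝ), φ x < t → ∀ ε > 0, ∀ᶠ m in atTop,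
      ∃ x' ∈ Metric.ball x ε, ψs m x' < t) :
    EpiTendsto ψs φ := by
  refine fun x => ⟨hliminf x, ?_⟩
  rcases eq_or_ne (φ x) ⊤ with htop | htop
  · exact ⟨fun _ => x, tendsto_const_nhds, tendsto_of_le_liminf_of_limsup_le
      (hliminf x _ tendsto_const_nhds) (htop ▸ le_top)⟩
  have hv : ((φ x).toReal : EReal) = φ x := EReal.coe_toReal htop (hbot x)
  obtain ⟨qs, hqs, hmem⟩ := exists_tendsto_of_eventually_dist_lt (p := (x, (φ x).toReal))
    (S := fun m => {q | ψs m q.1 ≤ (q.2 : EReal)}) fun ε hε => by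
      filter_upwards [hlt x ((φ x).toReal + ε / 2)
        (by rw [← hv]; exact EReal.coe_lt_coe_iff.2 (by simpa using hε)) ε hε]
        with m ⟨x', hx', hlt'⟩
      refine ⟨(x', (φ x).toReal + ε / 2), hlt'.le, max_lt (Metric.mem_ball'.1 hx') ?_⟩
      rw [dist_self_add_right, Real.norm_of_nonneg (half_pos hε).le]
      exact half_lt_self hε
  have hfst : Tendsto (fun m => (qs m).1) atTop (𝓝 x) := (continuous_fst.tendsto _).comp hqs
  have hsnd : Tendsto (fun m => ((qs m).2 : EReal)) atTop (𝓝 (φ x)) := by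
    rw [← hv]
    exact EReal.tendsto_coe.2 ((continuous_snd.tendsto _).comp hqs)
  refine ⟨_, hfst, tendsto_of_le_liminf_of_limsup_le (hliminf x _ hfst) ?_⟩
  exact (limsup_le_limsup (hmem.mono fun _ hm => hm)).trans_eq hsnd.limsup_eq

namespace MemConvC

variable {u : ℕ → E n}

theorem eventually_exists_iterSym_lt (hψ : MemConvC ψ) (hu : IsRecurrent u) {x : E n} {t : ℝ}
    (hxt : epiSym u ψ x < t) {ε : ℝ} (hε : 0 < ε) :
    ∀ᶠ m in atTop, ∃ x' ∈ Metric.ball x ε, iterSym u ψ m x' < t := by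
  by_contra hfreq
  simp only [not_eventually, not_exists, not_and, not_lt] at hfreq
  obtain ⟨c, hc⟩ := hψ.exists_coe_le
  set K := |t - c| / ε
  have hK : 0 ≤ K := by positivity
  have hcone : ∀ m, (∀ x' ∈ Metric.ball x ε, (t : EReal) ≤ iterSym u ψ m x') → ∀ a,
      ((t - K * dist a x : ℝ) : EReal) ≤ iterSym u ψ m a := fun m hm a => by
    rcases lt_or_ge (dist a x) ε with ha | ha
    · exact (EReal.coe_le_coe_iff.2 (sub_le_self _ (by positivity))).trans (hm a ha)
    · refine (EReal.coe_le_coe_iff.2 ?_).trans (coe_le_iterSym hc hu.norm_eq_one m a)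
      have hKε : |t - c| ≤ K * dist a x :=
        (div_mul_cancel₀ _ hε.ne').symm.trans_le (mul_le_mul_of_nonneg_left ha hK)
      linarith [le_abs_self (t - c)]
  obtain ⟨ms, hms, hge⟩ := extraction_of_frequently_atTop hfreq
  choose ys hysK hys using fun k =>
    have hm := hψ.iterSym hu.norm_eq_one (ms k)
    exists_affineMinorant_of_cone_le hm.convex_epi hm.exists_le_coe hK (hcone _ (hge k))
  obtain ⟨y, -, σ, hσ, hlim⟩ := (isCompact_closedBall (0 : E n) K).tendsto_subseq
    fun k => mem_closedBall_zero_iff.2 (hysK k)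
  have hmem : (y, inner ℝ x y - t) ∈ limMinorants u ψ := fun t' ht' => by
    obtain ⟨L, hL⟩ := hψ.exists_lipschitzWith_truncConj ht'
    refine le_of_tendsto_of_tendsto'
      (hu.tendsto_iterAvg_of_tendsto hL (hms.comp hσ).tendsto_atTop hlim)
      ((tendsto_const_nhds.inner hlim).sub_const t) fun k => ?_
    exact hψ.iterAvg_truncConj_le ht' hu.norm_eq_one (hys (σ k))
  have hge_t := coe_le_epiSym hmem x
  rw [sub_sub_cancel] at hge_t
  exact hxt.not_ge hge_t

theorem epiTendsto_iterSym (hψ : MemConvC ψ) (hu : IsRecurrent u) :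
    EpiTendsto (iterSym u ψ) (epiSym u ψ) :=
  epiTendsto_of_le_liminf (hψ.epiSym hu).ne_bot (fun _ _ hxs => hψ.epiSym_le_liminf_iterSym hu hxs)
    fun _ _ hxt _ hε => hψ.eventually_exists_iterSym_lt hu hxt hε

theorem exists_isEpiSymmetrization (hn : 1 ≤ n) (hψ : MemConvC ψ) :
    ∃ φ, IsEpiSymmetrization ψ φ := by
  obtain ⟨u, hu⟩ := exists_isRecurrent hn
  exact ⟨epiSym u ψ, hψ.epiSym hu, hψ.epiSym_isometry hu, u, hu.norm_eq_one,
    hψ.epiTendsto_iterSym hu⟩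

end MemConvC

/-! ### The relation between the values of a function and of its base function -/

section Profile

variable {α c t : ℝ} {e e' : EReal}

/-- The decreasing function `t ↦ (1 - α t)₊ ^ (1 / α)`, or `t ↦ exp (-t)` if `α = 0`, with value
`0` at `∞`, so that `ofBase α ψ = profile α ∘ ψ`. It is a bijection from `{t | 0 < 1 - α t}` onto
`(0, ∞)`; its value at `-∞` is junk. -/
def profile (α : ℝ) (e : EReal) : ℝ :=
  open Classical in
  if e = ⊤ then 0
  else if α = 0 then Real.exp (-e.toReal)
  else (max (1 - α * e.toReal) 0) ^ (1 / α)

theorem ofBase_apply (α : ℝ) (ψ : E n → EReal) (x : E n) : ofBase α ψ x = profile α (ψ x) := rfl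

theorem profile_top (α : ℝ) : profile α ⊤ = 0 := if_pos rfl

theorem profile_zero_coe (t : ℝ) : profile 0 (t : EReal) = Real.exp (-t) := by simp [profile]

theorem profile_coe_of_nonneg (hα : α ≠ 0) (ht : 0 ≤ 1 - α * t) :
    profile α (t : EReal) = (1 - α * t) ^ (1 / α) := by
  simp [profile, hα, ht]

theorem profile_coe_of_nonpos (hα : 0 < α) (ht : 1 - α * t ≤ 0) : profile α (t : EReal) = 0 := by
  simp only [profile, EReal.coe_ne_top, if_false, hα.ne', EReal.toReal_coe, max_eq_right ht,
    Real.zero_rpow (one_div_ne_zero hα.ne')]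

theorem profile_nonneg (α : ℝ) (e : EReal) : 0 ≤ profile α e := by
  unfold profile
  split_ifs
  · exact le_rfl
  · positivity
  · exact Real.rpow_nonneg (le_max_right _ _) _

theorem profile_coe_pos (ht : 0 < 1 - α * t) : 0 < profile α (t : EReal) := by
  rcases eq_or_ne α 0 with rfl | hα
  · rw [profile_zero_coe]
    positivity
  · rw [profile_coe_of_nonneg hα ht.le]
    exact Real.rpow_pos_of_pos ht _

theorem profile_rpow (hα : α ≠ 0) (ht : 0 ≤ 1 - α * t) : profile α (t : EReal) ^ α = 1 - α * t := by
  rw [profile_coe_of_nonneg hα ht, ← Real.rpow_mul ht, one_div_mul_cancel hα, Real.rpow_one]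

theorem exists_profile_eq (α : ℝ) {s : ℝ} (hs : 0 < s) :
    ∃ t : ℝ, 0 < 1 - α * t ∧ profile α (t : EReal) = s := by
  rcases eq_or_ne α 0 with rfl | hα
  · exact ⟨-Real.log s, by norm_num, by rw [profile_zero_coe, neg_neg, Real.exp_log hs]⟩
  · have hpow : 1 - α * ((1 - s ^ α) / α) = s ^ α := by
      field_simp
      ring
    have hpos : 0 < s ^ α := Real.rpow_pos_of_pos hs α
    refine ⟨(1 - s ^ α) / α, hpos.trans_eq hpow.symm, ?_⟩
    rw [profile_coe_of_nonneg hα (hpos.trans_eq hpow.symm).le, hpow, ← Real.rpow_mul hs.le,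
      mul_one_div_cancel hα, Real.rpow_one]

theorem strictAntiOn_profile (α : ℝ) :
    StrictAntiOn (fun t : ℝ => profile α (t : EReal)) {t | 0 < 1 - α * t} := by
  intro s (hs : 0 < 1 - α * s) t (ht : 0 < 1 - α * t) hst
  rcases lt_trichotomy α 0 with hα | rfl | hα
  · simp only [profile_coe_of_nonneg hα.ne, hs.le, ht.le]
    exact Real.rpow_lt_rpow_of_neg hs (by nlinarith) (one_div_neg.2 hα)
  · simp only [profile_zero_coe]
    exact Real.exp_lt_exp.2 (neg_lt_neg hst)
  · simp only [profile_coe_of_nonneg hα.ne', hs.le, ht.le]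
    exact Real.rpow_lt_rpow ht.le (by nlinarith) (one_div_pos.2 hα)

theorem one_sub_mul_pos_of_le_of_nonpos (hα : α ≤ 0) (hc : 0 < 1 - α * c) (h : c ≤ t) :
    0 < 1 - α * t := by
  nlinarith

theorem one_sub_mul_pos_of_le_of_nonneg (hα : 0 ≤ α) (hc : 0 < 1 - α * c) (h : t ≤ c) :
    0 < 1 - α * t := by
  nlinarith

theorem one_sub_mul_combo_pos {a b l : ℝ} (ha : 0 < 1 - α * a) (hb : 0 < 1 - α * b)
    (hl : l ∈ Set.Icc (0 : ℝ) 1) : 0 < 1 - α * (l * a + (1 - l) * b) := by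
  have h := (convex_Ioi (0 : ℝ)) ha hb hl.1 (sub_nonneg.2 hl.2) (add_sub_cancel _ _)
  rw [smul_eq_mul, smul_eq_mul, Set.mem_Ioi] at h
  linarith

theorem profile_pos_iff (hc : 0 < 1 - α * c) (he : (c : EReal) ≤ e) :
    0 < profile α e ↔ ∃ t : ℝ, e = t ∧ 0 < 1 - α * t := by
  refine ⟨fun h => ?_, ?_⟩
  · have htop : e ≠ ⊤ := by
      rintro rfl
      exact h.ne' (profile_top α)
    lift e to ℝ using ⟨htop, ne_bot_of_coe_le he⟩ with t
    refine ⟨t, rfl, ?_⟩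
    rcases le_or_gt α 0 with hα | hα
    · exact one_sub_mul_pos_of_le_of_nonpos hα hc (EReal.coe_le_coe_iff.1 he)
    · exact not_le.1 fun ht => h.ne' (profile_coe_of_nonpos hα ht)
  · rintro ⟨t, rfl, ht⟩
    exact profile_coe_pos ht

theorem profile_anti (hc : 0 < 1 - α * c) (he : (c : EReal) ≤ e) (hee' : e ≤ e') :
    profile α e' ≤ profile α e := by
  rcases (profile_nonneg α e').eq_or_lt with h | h
  · rw [← h]
    exact profile_nonneg α e
  · obtain ⟨t, rfl, ht⟩ := (profile_pos_iff hc (he.trans hee')).1 h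
    lift e to ℝ using
      ⟨ne_top_of_le_ne_top (EReal.coe_ne_top t) hee', ne_bot_of_coe_le he⟩ with s
    rw [EReal.coe_le_coe_iff] at he hee'
    have hs : 0 < 1 - α * s := by
      rcases le_total α 0 with hα | hα
      · exact one_sub_mul_pos_of_le_of_nonpos hα hc he
      · exact one_sub_mul_pos_of_le_of_nonneg hα ht hee'
    exact (strictAntiOn_profile α).antitoneOn hs ht hee'

theorem profile_coe_le_iff (hc : 0 < 1 - α * c) (he : (c : EReal) ≤ e) (ht : 0 < 1 - α * t) :
    profile α (t : EReal) ≤ profile α e ↔ e ≤ t := by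
  refine ⟨fun h => ?_, profile_anti hc he⟩
  obtain ⟨s, rfl, hs⟩ := (profile_pos_iff hc he).1 ((profile_coe_pos ht).trans_le h)
  exact EReal.coe_le_coe_iff.2 (((strictAntiOn_profile α).le_iff_ge ht hs).1 h)

theorem antitone_profile_max (hc : 0 < 1 - α * c) :
    Antitone fun e : EReal => profile α (max e c) := fun _ _ h =>
  profile_anti hc (le_max_right _ _) (max_le_max_right _ h)

theorem tendsto_profile_coe_atTop (α : ℝ) :
    Tendsto (fun t : ℝ => profile α (t : EReal)) atTop (𝓝 0) := by
  rcases lt_trichotomy α 0 with hα | rfl | hα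
  · have hlin : Tendsto (fun t : ℝ => 1 - α * t) atTop atTop := by
      simpa only [neg_mul, ← sub_eq_add_neg, id] using
        tendsto_atTop_add_const_left atTop 1 (tendsto_id.const_mul_atTop (neg_pos.2 hα))
    have hpow := (tendsto_rpow_neg_atTop (neg_pos.2 (one_div_neg.2 hα))).comp hlin
    rw [neg_neg] at hpow
    refine hpow.congr' ?_
    filter_upwards [hlin.eventually_ge_atTop 0] with t ht
    exact (profile_coe_of_nonneg hα.ne ht).symm
  · simpa only [profile_zero_coe] using Real.tendsto_exp_neg_atTop_nhds_zero
  · refine tendsto_const_nhds.congr' ?_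
    filter_upwards [eventually_ge_atTop (1 / α)] with t ht
    have := (div_le_iff₀' hα).1 ht
    exact (profile_coe_of_nonpos hα (by linarith)).symm

theorem continuousOn_profile_coe (hc : 0 < 1 - α * c) :
    ContinuousOn (fun t : ℝ => profile α (t : EReal)) (Set.Ici c) := by
  rcases eq_or_ne α 0 with rfl | hα
  · simp only [profile_zero_coe]
    fun_prop
  · simp only [profile, EReal.coe_ne_top, if_false, hα, EReal.toReal_coe]
    refine ContinuousOn.rpow_const (by fun_prop) fun t ht => ?_
    rcases lt_or_gt_of_ne hα with hα | hα
    · exact .inl (lt_max_of_lt_left (one_sub_mul_pos_of_le_of_nonpos hα.le hc ht)).ne'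
    · exact .inr (one_div_pos.2 hα).le

theorem continuousAt_profile_max_top (hc : 0 < 1 - α * c) :
    ContinuousAt (fun e : EReal => profile α (max e c)) ⊤ := by
  rw [ContinuousAt, max_eq_left le_top, profile_top]
  refine (nhds_basis_Ioo_pos (0 : ℝ)).tendsto_right_iff.2 fun ε hε => ?_
  obtain ⟨t, ht, hct⟩ := (((tendsto_profile_coe_atTop α).eventually (gt_mem_nhds hε)).and
    (eventually_ge_atTop c)).exists
  filter_upwards [lt_mem_nhds (EReal.coe_lt_top t)] with e he
  have hle : profile α (max e c) ≤ profile α t :=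
    profile_anti hc (EReal.coe_le_coe_iff.2 hct) (he.le.trans (le_max_left _ _))
  exact ⟨by linarith [profile_nonneg α (max e c)], by linarith⟩

theorem continuous_profile_max (hc : 0 < 1 - α * c) :
    Continuous fun e : EReal => profile α (max e c) := by
  rw [continuous_iff_continuousAt]
  intro e
  rcases eq_or_ne e ⊤ with rfl | he
  · exact continuousAt_profile_max_top hc
  have hcoe : ∀ e : EReal, e < ⊤ → ((max e (c : EReal)).toReal : EReal) = max e c := fun e he =>
    EReal.coe_toReal (max_lt he (EReal.coe_lt_top c)).ne (ne_bot_of_coe_le (le_max_right _ _))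
  have hmaps : ∀ e : EReal, e < ⊤ → (max e (c : EReal)).toReal ∈ Set.Ici c := fun e he => by
    rw [Set.mem_Ici, ← EReal.coe_le_coe_iff, hcoe e he]
    exact le_max_right _ _
  have htoReal : ContinuousOn (fun e : EReal => (max e (c : EReal)).toReal) (Set.Iio ⊤) :=
    EReal.continuousOn_toReal.comp (by fun_prop) fun e he => by
      rw [← hcoe e he]
      simp
  refine (((continuousOn_profile_coe hc).comp htoReal hmaps).congr fun e he => ?_).continuousAt
    (Iio_mem_nhds (lt_top_iff_ne_top.2 he))
  exact congrArg (profile α) (hcoe e he).symm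

theorem mean_profile {a b l : ℝ} (ha : 0 < 1 - α * a) (hb : 0 < 1 - α * b)
    (hl : l ∈ Set.Icc (0 : ℝ) 1) :
    mean (α : EReal) l (1 - l) (profile α (a : EReal)) (profile α (b : EReal))
      = profile α ((l * a + (1 - l) * b : ℝ) : EReal) := by
  rcases eq_or_ne α 0 with rfl | hα
  · simp only [mean, EReal.coe_zero, EReal.zero_ne_bot, EReal.zero_ne_top, if_false, if_true,
      profile_zero_coe]
    rw [← Real.exp_mul, ← Real.exp_mul, ← Real.exp_add]
    ring_nf
  · simp only [mean, EReal.coe_ne_bot, EReal.coe_ne_top, if_false, EReal.coe_eq_zero, hα,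
      EReal.toReal_coe]
    rw [profile_rpow hα ha.le, profile_rpow hα hb.le,
      profile_coe_of_nonneg hα (one_sub_mul_combo_pos ha hb hl).le]
    ring_nf

end Profile

/-! ### Base functions -/

section Base

variable {α t : ℝ} {f : E n → ℝ} {x : E n}

theorem base_eq_coe (ht : 0 < 1 - α * t) (hx : f x = profile α t) : base α f x = t := by
  have hpos : 0 < f x := hx ▸ profile_coe_pos ht
  have hval : α ≠ 0 → (1 - f x ^ α) / α = t := fun hα => by
    rw [hx, profile_rpow hα ht.le, sub_sub_cancel, mul_div_cancel_left₀ _ hα]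
  rcases lt_trichotomy α 0 with hα | rfl | hα
  · rw [base, if_neg hα.not_gt, if_pos hpos, if_neg hα.ne, hval hα.ne]
  · rw [base, if_neg (lt_irrefl _), if_pos hpos, if_pos rfl, hx, profile_zero_coe, Real.log_exp,
      neg_neg]
  · rw [base, if_pos hα, if_pos (subset_closure hpos : x ∈ closure (supp f)), hval hα.ne']

theorem base_of_mem_closure_supp (hα : 0 < α) (hx : x ∈ closure (supp f)) (h : f x = 0) :
    base α f x = ((1 / α : ℝ) : EReal) := by
  rw [base, if_pos hα, if_pos hx, h, Real.zero_rpow hα.ne', sub_zero]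

theorem base_of_notMem_closure_supp (hx : x ∉ closure (supp f)) : base α f x = ⊤ := by
  have hpos : ¬ 0 < f x := fun h => hx (subset_closure h)
  rw [base, if_neg hx, if_neg hpos, ite_self]

theorem coe_lt_base_of_eq_zero (ht : 0 < 1 - α * t) (h : f x = 0) : (t : EReal) < base α f x := by
  by_cases hx : 0 < α ∧ x ∈ closure (supp f)
  · rw [base_of_mem_closure_supp hx.1 hx.2 h, EReal.coe_lt_coe_iff, lt_div_iff₀' hx.1]
    linarith
  · have htop : base α f x = ⊤ := by
      rcases not_and_or.1 hx with hα | hx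
      · rw [base, if_neg hα, h, if_neg (lt_irrefl _)]
      · exact base_of_notMem_closure_supp hx
    rw [htop]
    exact EReal.coe_lt_top t

theorem base_ne_bot (α : ℝ) (f : E n → ℝ) (x : E n) : base α f x ≠ ⊥ := by
  unfold base
  split_ifs <;> simp only [ne_eq, EReal.coe_ne_bot, not_false_eq_true, top_ne_bot]

theorem base_le_coe_iff (hf : ∀ x, 0 ≤ f x) (ht : 0 < 1 - α * t) :
    base α f x ≤ t ↔ profile α t ≤ f x := by
  rcases (hf x).eq_or_lt with hx | hx
  · rw [← hx]
    exact iff_of_false (coe_lt_base_of_eq_zero ht hx.symm).not_ge (profile_coe_pos ht).not_ge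
  · obtain ⟨s, hs, hsx⟩ := exists_profile_eq α hx
    rw [base_eq_coe hs hsx.symm, ← hsx, EReal.coe_le_coe_iff]
    exact ((strictAntiOn_profile α).le_iff_ge ht hs).symm

theorem base_le_one_div (hα : 0 < α) (hf : ∀ x, 0 ≤ f x) (hx : x ∈ closure (supp f)) :
    base α f x ≤ ((1 / α : ℝ) : EReal) := by
  rw [base, if_pos hα, if_pos hx, EReal.coe_le_coe_iff]
  exact div_le_div_of_nonneg_right (sub_le_self _ (Real.rpow_nonneg (hf x) α)) hα.le

theorem base_le_coe_iff_mem_closure (hα : 0 < α) (hf : ∀ x, 0 ≤ f x) (ht : 1 - α * t ≤ 0) :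
    base α f x ≤ t ↔ x ∈ closure (supp f) := by
  refine ⟨fun h => ?_, fun h => (base_le_one_div hα hf h).trans ?_⟩
  · by_contra hx
    rw [base_of_notMem_closure_supp hx, top_le_iff] at h
    exact EReal.coe_ne_top t h
  · rw [EReal.coe_le_coe_iff, div_le_iff₀' hα]
    linarith

theorem one_sub_mul_pos_of_base_le (hα : α ≤ 0) (hf : ∀ x, 0 ≤ f x) (h : base α f x ≤ t) :
    0 < 1 - α * t := by
  have hmax : 0 < 1 - α * max t 0 := by nlinarith [le_max_right t 0]
  have hpos : 0 < f x := (profile_coe_pos hmax).trans_le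
    ((base_le_coe_iff hf hmax).1 (h.trans (EReal.coe_le_coe_iff.2 (le_max_left t 0))))
  obtain ⟨s, hs, hsx⟩ := exists_profile_eq α hpos
  rw [base_eq_coe hs hsx.symm, EReal.coe_le_coe_iff] at h
  exact one_sub_mul_pos_of_le_of_nonpos hα hs h

theorem ofBase_base (hf : ∀ x, 0 ≤ f x) : ofBase α (base α f) = f := by
  funext x
  rw [ofBase_apply]
  rcases (hf x).eq_or_lt with hx | hx
  · by_cases h : 0 < α ∧ x ∈ closure (supp f)
    · rw [base_of_mem_closure_supp h.1 h.2 hx.symm, ← hx]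
      exact profile_coe_of_nonpos h.1 (by rw [mul_one_div_cancel h.1.ne', sub_self])
    · have htop : base α f x = ⊤ := by
        rcases not_and_or.1 h with hα | hcl
        · rw [base, if_neg hα, ← hx, if_neg (lt_irrefl _)]
        · exact base_of_notMem_closure_supp hcl
      rw [htop, profile_top, hx]
  · obtain ⟨s, hs, hsx⟩ := exists_profile_eq α hx
    rw [base_eq_coe hs hsx.symm, hsx]

end Base

namespace MemC

variable {α : ℝ} {f : E n → ℝ}

theorem profile_combo_le (hf : MemC α f) {x y : E n} {a b l : ℝ} (ha : 0 < 1 - α * a)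
    (hb : 0 < 1 - α * b) (hl : l ∈ Set.Icc (0 : ℝ) 1) (hx : f x = profile α a)
    (hy : f y = profile α b) :
    profile α ((l * a + (1 - l) * b : ℝ) : EReal) ≤ f (l • x + (1 - l) • y) := by
  rw [← mean_profile ha hb hl, ← hx, ← hy]
  exact hf.alphaConcave.2 x ((profile_coe_pos ha).trans_eq hx.symm)
    y ((profile_coe_pos hb).trans_eq hy.symm) l hl

theorem convex_epi_supp (hf : MemC α f) :
    Convex ℝ {p : E n × ℝ | p.1 ∈ supp f ∧ base α f p.1 ≤ (p.2 : EReal)} := by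
  rintro ⟨x, s⟩ ⟨hx, hxs⟩ ⟨y, t⟩ ⟨hy, hyt⟩ l q hl hq hlq
  obtain rfl : q = 1 - l := by linarith
  have hl' : l ∈ Set.Icc (0 : ℝ) 1 := ⟨hl, by linarith⟩
  obtain ⟨a, ha, hax⟩ := exists_profile_eq α hx
  obtain ⟨b, hb, hby⟩ := exists_profile_eq α hy
  rw [base_eq_coe ha hax.symm, EReal.coe_le_coe_iff] at hxs
  rw [base_eq_coe hb hby.symm, EReal.coe_le_coe_iff] at hyt
  have hab := one_sub_mul_combo_pos ha hb hl'
  have hle := hf.profile_combo_le ha hb hl' hax.symm hby.symm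
  refine ⟨(profile_coe_pos hab).trans_le hle, ((base_le_coe_iff hf.nonneg hab).2 hle).trans ?_⟩
  rw [EReal.coe_le_coe_iff]
  exact add_le_add (mul_le_mul_of_nonneg_left hxs hl) (mul_le_mul_of_nonneg_left hyt hq)

theorem isCompact_le (hf : MemC α f) {s : ℝ} (hs : 0 < s) : IsCompact {x | s ≤ f x} := by
  obtain ⟨K, hK, hKs⟩ := mem_cocompact.1 (hf.tendsto_zero.eventually (gt_mem_nhds hs))
  refine hK.of_isClosed_subset (upperSemicontinuous_iff_isClosed_preimage.1 hf.usc s) fun x hx => ?_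
  by_contra hxK
  have hlt : f x < s := hKs hxK
  exact hlt.not_ge hx

/-- The values of `base α f` on the support are at most `1 / α`, so by convexity they stay below a
constant smaller than `1 / α` halfway to a fixed point of the support. -/
theorem isCompact_closure_supp (hf : MemC α f) (hα : 0 < α) : IsCompact (closure (supp f)) := by
  obtain ⟨x₀, hx₀⟩ := hf.proper
  obtain ⟨a, ha, hax⟩ := exists_profile_eq α hx₀
  have hc : 0 < 1 - α * (1 / 2 * (1 / α) + 1 / 2 * a) := by
    field_simp
    linarith
  have hK := (hf.isCompact_le (profile_coe_pos hc)).image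
    (f := fun z : E n => (2 : ℝ) • z - x₀) (by fun_prop)
  refine hK.closure_of_subset fun x hx => ?_
  have hmid : base α f ((1 / 2 : ℝ) • x + (1 / 2 : ℝ) • x₀)
      ≤ ((1 / 2 * (1 / α) + 1 / 2 * a : ℝ) : EReal) :=
    (hf.convex_epi_supp (x := (x, 1 / α)) ⟨hx, base_le_one_div hα hf.nonneg (subset_closure hx)⟩
      (y := (x₀, a)) ⟨hx₀, (base_eq_coe ha hax.symm).le⟩
      one_half_pos.le one_half_pos.le (add_halves 1)).2
  refine ⟨_, (base_le_coe_iff hf.nonneg hc).1 hmid, ?_⟩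
  module

theorem isCompact_base_le (hf : MemC α f) (t : ℝ) : IsCompact {x | base α f x ≤ t} := by
  rcases lt_or_ge 0 (1 - α * t) with ht | ht
  · simp only [base_le_coe_iff hf.nonneg ht]
    exact hf.isCompact_le (profile_coe_pos ht)
  · rcases le_or_gt α 0 with hα | hα
    · convert isCompact_empty
      exact Set.eq_empty_of_forall_notMem fun x hx =>
        ht.not_gt (one_sub_mul_pos_of_base_le hα hf.nonneg hx)
    · simp only [base_le_coe_iff_mem_closure hα hf.nonneg ht]
      exact hf.isCompact_closure_supp hα

theorem epi_base (hf : MemC α f) : {p : E n × ℝ | base α f p.1 ≤ (p.2 : EReal)} =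
    closure {p : E n × ℝ | p.1 ∈ supp f ∧ base α f p.1 ≤ (p.2 : EReal)} := by
  refine subset_antisymm ?_ (closure_minimal (fun p hp => hp.2) (isClosed_epi
    (lowerSemicontinuous_of_isClosed_coe fun t => (hf.isCompact_base_le t).isClosed)))
  rintro ⟨x, t⟩ (hxt : base α f x ≤ t)
  rcases (hf.nonneg x).eq_or_lt with hx | hx
  · have ht : 1 - α * t ≤ 0 := not_lt.1 fun ht => hxt.not_gt (coe_lt_base_of_eq_zero ht hx.symm)
    have hα : 0 < α := not_le.1 fun hα =>
      ht.not_gt (one_sub_mul_pos_of_base_le hα hf.nonneg hxt)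
    have hcl := (base_le_coe_iff_mem_closure hα hf.nonneg ht).1 hxt
    have hprod : (x, t) ∈ closure (supp f ×ˢ {t}) := by
      rw [closure_prod_eq, closure_singleton]
      exact ⟨hcl, rfl⟩
    refine closure_mono ?_ hprod
    rintro ⟨y, _⟩ ⟨hy, rfl⟩
    exact ⟨hy, (base_le_coe_iff_mem_closure hα hf.nonneg ht).2 (subset_closure hy)⟩
  · exact subset_closure ⟨hx, hxt⟩

theorem memConvC_base (hf : MemC α f) : MemConvC (base α f) := by
  refine MemConvC.of_isCompact_sublevel (hf.epi_base ▸ hf.convex_epi_supp.closure)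
    hf.isCompact_base_le (base_ne_bot α f) ?_
  obtain ⟨x, hx⟩ := hf.proper
  obtain ⟨t, ht, htx⟩ := exists_profile_eq α hx
  exact ⟨x, base_eq_coe ht htx.symm ▸ EReal.coe_ne_top t⟩

end MemC

theorem eq_of_forall_le_coe_iff {a b : EReal} (h : ∀ t : ℝ, a ≤ t ↔ b ≤ t) : a = b :=
  le_antisymm (EReal.le_of_forall_lt_iff_le.1 fun t ht => (h t).2 ht.le)
    (EReal.le_of_forall_lt_iff_le.1 fun t ht => (h t).1 ht.le)

theorem MemConvC.le_combo (hψ : MemConvC ψ) {x y : E n} {s t p q : ℝ}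
    (hx : ψ x ≤ s) (hy : ψ y ≤ t) (hp : 0 ≤ p) (hq : 0 ≤ q) (hpq : p + q = 1) :
    ψ (p • x + q • y) ≤ ((p * s + q * t : ℝ) : EReal) :=
  hψ.convex_epi (x := (x, s)) hx (y := (y, t)) hy hp hq hpq

/-- The functions of `Conv_c(ℝⁿ)` bounded below by `c` that are base functions of elements of
`C_α(ℝⁿ)`. The constant `c` is recorded because symmetrization preserves it, and so makes the
estimates uniform along a sequence of symmetrizations. -/
structure MemBase (α c : ℝ) (ψ : E n → EReal) : Prop where
  pos : 0 < 1 - α * c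
  conv : MemConvC ψ
  lower : ∀ x, (c : EReal) ≤ ψ x
  upper : 0 < α → ∀ x, ψ x ≠ ⊤ → ψ x ≤ ((1 / α : ℝ) : EReal)
  exists_ball : ∃ (x₀ : E n) (r C : ℝ), 0 < r ∧ 0 < 1 - α * C ∧
    ∀ y ∈ Metric.ball x₀ r, ψ y ≤ (C : EReal)

section MemBase

variable {α c : ℝ} {f : E n → ℝ}

namespace MemBase

theorem mem_supp_iff (hψ : MemBase α c ψ) {x : E n} :
    x ∈ supp (ofBase α ψ) ↔ ∃ t : ℝ, ψ x = t ∧ 0 < 1 - α * t :=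
  profile_pos_iff hψ.pos (hψ.lower x)

theorem mem_supp_of_le (hψ : MemBase α c ψ) {x : E n} {t : ℝ} (ht : 0 < 1 - α * t)
    (hx : ψ x ≤ t) : x ∈ supp (ofBase α ψ) :=
  (profile_coe_pos ht).trans_le (profile_anti hψ.pos (hψ.lower x) hx)

theorem alphaConcave (hψ : MemBase α c ψ) : AlphaConcave α (ofBase α ψ) := by
  have hmean : ∀ x ∈ supp (ofBase α ψ), ∀ y ∈ supp (ofBase α ψ), ∀ l ∈ Set.Icc (0 : ℝ) 1,
      0 < mean (α : EReal) l (1 - l) (ofBase α ψ x) (ofBase α ψ y) ∧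
        mean (α : EReal) l (1 - l) (ofBase α ψ x) (ofBase α ψ y)
          ≤ ofBase α ψ (l • x + (1 - l) • y) := by
    intro x hx y hy l hl
    obtain ⟨a, hxa, ha⟩ := hψ.mem_supp_iff.1 hx
    obtain ⟨b, hyb, hb⟩ := hψ.mem_supp_iff.1 hy
    rw [ofBase_apply, ofBase_apply, ofBase_apply, hxa, hyb, mean_profile ha hb hl]
    exact ⟨profile_coe_pos (one_sub_mul_combo_pos ha hb hl), profile_anti hψ.pos (hψ.lower _)
      (hψ.conv.le_combo hxa.le hyb.le hl.1 (sub_nonneg.2 hl.2) (add_sub_cancel _ _))⟩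
  refine ⟨fun x hx y hy p q hp hq hpq => ?_, fun x hx y hy l hl => (hmean x hx y hy l hl).2⟩
  obtain rfl : q = 1 - p := by linarith
  have h := hmean x hx y hy p ⟨hp, by linarith⟩
  exact h.1.trans_le h.2

theorem ofBase_eq_profile_max (hψ : MemBase α c ψ) :
    ofBase α ψ = fun x => profile α (max (ψ x) c) := by
  funext x
  rw [ofBase_apply, max_eq_left (hψ.lower x)]

protected theorem memC (hψ : MemBase α c ψ) : MemC α (ofBase α ψ) := by
  obtain ⟨x₀, r, C, hr, hC, hball⟩ := hψ.exists_ball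
  have hsub : Metric.ball x₀ r ⊆ supp (ofBase α ψ) := fun y hy => hψ.mem_supp_of_le hC (hball y hy)
  refine ⟨fun x => profile_nonneg α (ψ x), hψ.alphaConcave, ⟨x₀, hsub (Metric.mem_ball_self hr)⟩,
    ?_, ?_, ?_⟩
  · rw [hψ.ofBase_eq_profile_max]
    exact (continuous_profile_max hψ.pos).comp_lowerSemicontinuous_antitone hψ.conv.lsc
      (antitone_profile_max hψ.pos)
  · rw [eq_top_iff, ← Metric.isOpen_ball.affineSpan_eq_top ⟨x₀, Metric.mem_ball_self hr⟩]
    exact affineSpan_mono ℝ hsub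
  · rw [hψ.ofBase_eq_profile_max]
    have h := ((continuous_profile_max hψ.pos).tendsto ⊤).comp hψ.conv.coercive
    rwa [max_eq_left le_top, profile_top] at h

/-- Every point at which `ψ` is finite is joined to an interior point of the support by a segment
whose other points lie in the support. -/
theorem closure_supp_ofBase (hψ : MemBase α c ψ) (hα : 0 < α) :
    closure (supp (ofBase α ψ)) = {x | ψ x ≠ ⊤} := by
  refine subset_antisymm (fun x hx => ?_) fun x hx => ?_
  · have hsub : supp (ofBase α ψ) ⊆ {x | ψ x ≤ ((1 / α : ℝ) : EReal)} := fun y hy => by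
      obtain ⟨t, hyt, -⟩ := hψ.mem_supp_iff.1 hy
      exact hψ.upper hα y (hyt ▸ EReal.coe_ne_top t)
    exact ne_top_of_le_ne_top (EReal.coe_ne_top _)
      (closure_minimal hsub (hψ.conv.isCompact_sublevel _).isClosed hx)
  · obtain ⟨x₀, r, C, hr, hC, hball⟩ := hψ.exists_ball
    have hseg : openSegment ℝ x x₀ ⊆ supp (ofBase α ψ) := by
      rintro _ ⟨p, q, hp, hq, hpq, rfl⟩
      refine hψ.mem_supp_of_le ?_ (hψ.conv.le_combo (hψ.upper hα x hx)
        (hball x₀ (Metric.mem_ball_self hr)) hp.le hq.le hpq)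
      have hval : 1 - α * (p * (1 / α) + q * C) = q * (1 - α * C) := by
        obtain rfl : p = 1 - q := by linarith
        field_simp
        ring
      rw [hval]
      exact mul_pos hq hC
    have hcl := closure_mono hseg
    rw [closure_openSegment] at hcl
    exact hcl (left_mem_segment ℝ x x₀)

theorem base_ofBase (hψ : MemBase α c ψ) : base α (ofBase α ψ) = ψ := by
  have hnonneg : ∀ x, 0 ≤ ofBase α ψ x := fun x => profile_nonneg α (ψ x)
  refine funext fun x => eq_of_forall_le_coe_iff fun t => ?_
  rcases lt_or_ge 0 (1 - α * t) with ht | ht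
  · rw [base_le_coe_iff hnonneg ht, ofBase_apply, profile_coe_le_iff hψ.pos (hψ.lower x) ht]
  rcases le_or_gt α 0 with hα | hα
  · refine iff_of_false (fun h => ht.not_gt (one_sub_mul_pos_of_base_le hα hnonneg h)) fun h => ?_
    exact ht.not_gt (one_sub_mul_pos_of_le_of_nonpos hα hψ.pos
      (EReal.coe_le_coe_iff.1 ((hψ.lower x).trans h)))
  · rw [base_le_coe_iff_mem_closure hα hnonneg ht, hψ.closure_supp_ofBase hα]
    refine ⟨fun hx => (hψ.upper hα x hx).trans ?_, ne_top_of_le_ne_top (EReal.coe_ne_top t)⟩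
    rw [EReal.coe_le_coe_iff, div_le_iff₀' hα]
    linarith

theorem comp_isometry (hψ : MemBase α c ψ) (T : E n ≃ₗᵢ[ℝ] E n) :
    MemBase α c fun x => ψ (T x) where
  pos := hψ.pos
  conv := hψ.conv.comp_isometry T
  lower x := hψ.lower (T x)
  upper hα x := hψ.upper hα (T x)
  exists_ball := by
    obtain ⟨x₀, r, C, hr, hC, hball⟩ := hψ.exists_ball
    refine ⟨T.symm x₀, r, C, hr, hC, fun y hy => hball (T y) ?_⟩
    rwa [Metric.mem_ball, ← T.dist_map, T.apply_symm_apply] at hy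

theorem epiMul (hψ : MemBase α c ψ) {l : ℝ} (hl : 0 < l) (hl' : l ≤ 1) :
    MemBase α (l * c) (epiMul l ψ) where
  pos := by nlinarith [mul_pos hl hψ.pos]
  conv := hψ.conv.epiMul hl
  lower x := by
    rw [EReal.coe_mul]
    exact mul_le_mul_of_nonneg_left (hψ.lower _) (EReal.coe_nonneg.2 hl.le)
  upper hα x hx := by
    have hfin : ψ (l⁻¹ • x) ≠ ⊤ := fun h => hx (by
      rw [HypoSym.epiMul, h, EReal.coe_mul_top_of_pos hl])
    rw [HypoSym.epiMul, coe_mul_le_coe_iff hl]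
    refine (hψ.upper hα _ hfin).trans (EReal.coe_le_coe_iff.2 ?_)
    exact le_mul_of_one_le_left (one_div_pos.2 hα).le ((one_le_inv₀ hl).2 hl')
  exists_ball := by
    obtain ⟨x₀, r, C, hr, hC, hball⟩ := hψ.exists_ball
    refine ⟨l • x₀, l * r, l * C, mul_pos hl hr, by nlinarith [mul_pos hl hC], fun y hy => ?_⟩
    rw [HypoSym.epiMul, coe_mul_le_coe_iff hl, inv_mul_cancel_left₀ hl.ne']
    refine hball _ ?_
    rw [Metric.mem_ball, dist_eq_norm] at hy ⊢
    rw [← inv_smul_smul₀ hl.ne' x₀, ← smul_sub, norm_smul, norm_inv, Real.norm_of_nonneg hl.le,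
      inv_mul_lt_iff₀ hl]
    exact hy

end MemBase

namespace MemC

theorem exists_ball (hf : MemC α f) :
    ∃ (x₀ : E n) (r C : ℝ), 0 < r ∧ 0 < 1 - α * C ∧
      ∀ y ∈ Metric.ball x₀ r, base α f y ≤ (C : EReal) := by
  obtain ⟨s, hs, b, hb⟩ := AffineBasis.exists_affine_subbasis hf.fullDim
  have hfin : s.Finite := finite_set_of_fin_dim_affineIndependent ℝ (hb ▸ b.ind)
  have hspan : affineSpan ℝ s = ⊤ := by
    have := b.tot
    rwa [hb, Subtype.range_coe] at this
  obtain ⟨i⟩ := b.nonempty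
  obtain ⟨z, hz, hmin⟩ := Set.exists_min_image s f hfin ⟨i, i.2⟩
  obtain ⟨C, hC, hCz⟩ := exists_profile_eq α (hs hz)
  have hconv : Convex ℝ {x | base α f x ≤ (C : EReal)} := fun x hx y hy p q hp hq hpq => by
    have := hf.memConvC_base.le_combo hx hy hp hq hpq
    rwa [← add_mul, hpq, one_mul] at this
  have hsimplex : convexHull ℝ s ⊆ {x | base α f x ≤ (C : EReal)} :=
    convexHull_min (fun x hx => (base_le_coe_iff hf.nonneg hC).2 (hCz.trans_le (hmin x hx))) hconv
  obtain ⟨x₀, hx₀⟩ := interior_convexHull_nonempty_iff_affineSpan_eq_top.2 hspan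
  obtain ⟨r, hr, hball⟩ := Metric.isOpen_iff.1 isOpen_interior x₀ hx₀
  exact ⟨x₀, r, C, hr, hC, fun y hy => hsimplex (interior_subset (hball hy))⟩

theorem exists_memBase (hf : MemC α f) : ∃ c : ℝ, MemBase α c (base α f) := by
  obtain ⟨x₀, hmin⟩ := hf.memConvC_base.exists_forall_le
  obtain ⟨x₁, hx₁⟩ := hf.proper
  obtain ⟨a, ha, hax⟩ := exists_profile_eq α hx₁
  have hx₀ : 0 < f x₀ := (profile_coe_pos ha).trans_le ((base_le_coe_iff hf.nonneg ha).1
    ((hmin x₁).trans (base_eq_coe ha hax.symm).le))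
  obtain ⟨c, hc, hcx⟩ := exists_profile_eq α hx₀
  exact ⟨c, hc, hf.memConvC_base, fun x => base_eq_coe hc hcx.symm ▸ hmin x,
    fun hα x hx => base_le_one_div hα hf.nonneg
      (not_imp_comm.1 base_of_notMem_closure_supp hx), hf.exists_ball⟩

theorem base_comp_isometry (hf : MemC α f) (T : E n ≃ₗᵢ[ℝ] E n) :
    base α (fun x => f (T x)) = fun x => base α f (T x) := by
  obtain ⟨c, hc⟩ := hf.exists_memBase
  nth_rw 1 [← ofBase_base (α := α) hf.nonneg]
  exact (hc.comp_isometry T).base_ofBase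

theorem comp_isometry (hf : MemC α f) (T : E n ≃ₗᵢ[ℝ] E n) : MemC α fun x => f (T x) := by
  obtain ⟨c, hc⟩ := hf.exists_memBase
  rw [← ofBase_base (α := α) hf.nonneg]
  exact (hc.comp_isometry T).memC

theorem base_homothety (hf : MemC α f) {l : ℝ} (hl : 0 < l) (hl' : l ≤ 1) :
    base α (homothety α l f) = epiMul l (base α f) := by
  obtain ⟨c, hc⟩ := hf.exists_memBase
  exact (hc.epiMul hl hl').base_ofBase

end MemC

end MemBase

/-! ### Symmetrization on `C_α(ℝⁿ)` -/

section Symmetrization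

variable {α c r C : ℝ} {f g : E n → ℝ} {u x₀ : E n} {us : ℕ → E n}

theorem exists_of_minkSym_ne_top (hψ : MemConvC ψ) (hu : ‖u‖ = 1) {x : E n}
    (hx : minkSym u ψ x ≠ ⊤) :
    ∃ a b : E n, ψ a ≠ ⊤ ∧ ψ b ≠ ⊤ ∧ x = (1 / 2 : ℝ) • (a + reflect u b) := by
  obtain ⟨y, z, s, s', hy, hz, rfl, -⟩ := (MemConvC.infConv_le_coe_iff (hψ.epiMul one_half_pos)
    ((hψ.comp_reflect hu).epiMul one_half_pos)).1 (EReal.le_coe_toReal hx)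
  rw [epiMul, coe_mul_le_coe_iff one_half_pos] at hy hz
  refine ⟨_, _, ne_top_of_le_ne_top (EReal.coe_ne_top _) hy,
    ne_top_of_le_ne_top (EReal.coe_ne_top _) hz, ?_⟩
  rw [reflect_reflect hu, ← smul_add, smul_inv_smul₀ one_half_pos.ne']

theorem minkSym_le_on_ball (hu : ‖u‖ = 1) (hball : ∀ y ∈ Metric.ball x₀ r, ψ y ≤ (C : EReal)) :
    ∀ y ∈ Metric.ball ((1 / 2 : ℝ) • (x₀ + reflect u x₀)) r, minkSym u ψ y ≤ (C : EReal) := by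
  intro y hy
  obtain ⟨v, rfl⟩ : ∃ v, y = (1 / 2 : ℝ) • (x₀ + reflect u x₀) + v := 
    ⟨y - (1 / 2 : ℝ) • (x₀ + reflect u x₀), (add_sub_cancel _ _).symm⟩
  rw [mem_ball_iff_norm, add_sub_cancel_left] at hy
  have hleft : ψ (x₀ + v) ≤ (C : EReal) :=
    hball _ (by rwa [mem_ball_iff_norm, add_sub_cancel_left])
  have hright : ψ (x₀ + reflect u v) ≤ (C : EReal) :=
    hball _ (by rwa [mem_ball_iff_norm, add_sub_cancel_left, norm_reflect hu])
  convert minkSym_le hu hleft hright using 2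
  · rw [reflect_add, reflect_reflect hu]
    module
  · ring

theorem iterSym_le_on_ball (hus : ∀ i, ‖us i‖ = 1)
    (hball : ∀ y ∈ Metric.ball x₀ r, ψ y ≤ (C : EReal)) (m : ℕ) :
    ∃ x : E n, ‖x‖ ≤ ‖x₀‖ ∧ ∀ y ∈ Metric.ball x r, iterSym us ψ m y ≤ (C : EReal) := by
  induction m with
  | zero => exact ⟨x₀, le_rfl, hball⟩
  | succ m ih =>
    obtain ⟨x, hx, hxball⟩ := ih
    refine ⟨_, ?_, minkSym_le_on_ball (hus m) hxball⟩
    have hadd := norm_add_le x (reflect (us m) x)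
    rw [norm_reflect (hus m)] at hadd
    rw [norm_smul, Real.norm_of_nonneg one_half_pos.le]
    linarith

theorem EpiTendsto.exists_le_on_ball {ψs : ℕ → E n → EReal} (h : EpiTendsto ψs φ) {xs : ℕ → E n}
    {R : ℝ} (hxs : ∀ m, ‖xs m‖ ≤ R)
    (hball : ∀ m, ∀ y ∈ Metric.ball (xs m) r, ψs m y ≤ (C : EReal)) :
    ∃ x : E n, ∀ y ∈ Metric.ball x r, φ y ≤ (C : EReal) := by
  obtain ⟨x, -, k, hk, hlim⟩ := (isCompact_closedBall (0 : E n) R).tendsto_subseq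
    (x := xs) fun m => mem_closedBall_zero_iff.2 (hxs m)
  refine ⟨x, fun y hy => ((h y).1 (fun _ => y) tendsto_const_nhds).trans ?_⟩
  refine liminf_le_of_frequently_le (hk.tendsto_atTop.frequently (Eventually.frequently ?_))
  filter_upwards [hlim.eventually (Metric.isOpen_ball.mem_nhds (Metric.mem_ball_comm.1 hy))]
    with m hm
  exact hball _ y (Metric.mem_ball_comm.1 hm)

namespace MemBase

protected theorem minkSym (hψ : MemBase α c ψ) (hu : ‖u‖ = 1) : MemBase α c (minkSym u ψ) where
  pos := hψ.pos
  conv := hψ.conv.minkSym hu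
  lower _ := coe_le_minkSym hu (f := fun _ => c) (g := fun _ => c) hψ.lower hψ.lower
    fun _ _ _ => by linarith
  upper hα x hx := by
    obtain ⟨a, b, ha, hb, rfl⟩ := exists_of_minkSym_ne_top hψ.conv hu hx
    convert minkSym_le hu (hψ.upper hα a ha) (hψ.upper hα b hb) using 2
    ring
  exists_ball := by
    obtain ⟨x₀, r, C, hr, hC, hball⟩ := hψ.exists_ball
    exact ⟨_, r, C, hr, hC, minkSym_le_on_ball hu hball⟩

protected theorem iterSym (hψ : MemBase α c ψ) (hus : ∀ i, ‖us i‖ = 1) (m : ℕ) :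
    MemBase α c (iterSym us ψ m) := by
  induction m with
  | zero => exact hψ
  | succ m ih => exact ih.minkSym (hus m)

theorem of_epiTendsto (hψ : MemBase α c ψ) (hus : ∀ i, ‖us i‖ = 1) (hφ : MemConvC φ)
    (h : EpiTendsto (iterSym us ψ) φ) : MemBase α c φ where
  pos := hψ.pos
  conv := hφ
  lower x := by
    obtain ⟨xs, -, hlim⟩ := (h x).2
    exact ge_of_tendsto' hlim fun m => (hψ.iterSym hus m).lower _
  upper hα x hx := by
    obtain ⟨xs, -, hlim⟩ := (h x).2
    refine le_of_tendsto hlim ?_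
    filter_upwards [hlim.eventually (gt_mem_nhds (lt_top_iff_ne_top.2 hx))] with m hm
    exact (hψ.iterSym hus m).upper hα _ hm.ne
  exists_ball := by
    obtain ⟨x₀, r, C, hr, hC, hball⟩ := hψ.exists_ball
    choose xs hxs hxsball using iterSym_le_on_ball hus hball
    obtain ⟨x, hx⟩ := h.exists_le_on_ball hxs hxsball
    exact ⟨x, r, C, hr, hC, hx⟩

end MemBase

theorem HypoTendsto.of_epiTendsto {ψs : ℕ → E n → EReal} (hψ : ∀ m, MemBase α c (ψs m))
    (hφ : MemBase α c φ) (h : EpiTendsto ψs φ) :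
    HypoTendsto (fun m => ofBase α (ψs m)) (ofBase α φ) := by
  simp only [hφ.ofBase_eq_profile_max, (hψ _).ofBase_eq_profile_max]
  have hcont := continuous_profile_max hφ.pos
  have hanti : Antitone fun e : EReal => (profile α (max e c) : EReal) := fun _ _ hle =>
    EReal.coe_le_coe_iff.2 (antitone_profile_max hφ.pos hle)
  refine fun x => ⟨fun xs hxs => ?_, ?_⟩
  · refine (hanti.map_liminf_of_continuousAt (F := atTop) (fun j => ψs j (xs j))
      (continuous_coe_real_ereal.comp hcont).continuousAt).ge.trans (hanti ((h x).1 xs hxs))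
  · obtain ⟨xs, hxs, hlim⟩ := (h x).2
    exact ⟨xs, hxs, (hcont.tendsto _).comp hlim⟩

/-- The Minkowski symmetral of `f` in the direction `u`: the function whose base function is the
Minkowski symmetral of the base function of `f`. -/
def hypoMinkSym (α : ℝ) (u : E n) (f : E n → ℝ) : E n → ℝ := ofBase α (minkSym u (base α f))

theorem asplund_homothety_half (hf : MemC α f) (hu : ‖u‖ = 1) :
    asplund α (homothety α (1 / 2) f) (homothety α (1 - 1 / 2) fun x => f (reflectIso u x))
      = hypoMinkSym α u f := by
  rw [asplund, sub_half, hf.base_homothety one_half_pos one_half_lt_one.le,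
    (hf.comp_isometry _).base_homothety one_half_pos one_half_lt_one.le, hf.base_comp_isometry]
  simp only [reflectIso_apply hu]
  rfl

theorem mean_half_self (p : EReal) {a : ℝ} (ha : 0 < a) : mean p (1 / 2) (1 - 1 / 2) a a = a := by
  rw [mean, sub_half]
  split_ifs with hbot htop hzero
  · exact min_self a
  · exact max_self a
  · rw [← Real.rpow_add ha, add_halves, Real.rpow_one]
  · rw [← add_mul, add_halves, one_mul, one_div,
      Real.rpow_rpow_inv ha.le (EReal.toReal_ne_zero_iff.2 ⟨hzero, htop, hbot⟩)]

variable {F : (E n → ℝ) → ℝ}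

theorem SupConvConvex.hypoMinkSym_le (hF : SupConvConvex α F) (hpos : PosOn α F)
    (hO : OrthInvariant α F) (hf : MemC α f) (hu : ‖u‖ = 1) : F (hypoMinkSym α u f) ≤ F f := by
  have h := hF f _ hf (hf.comp_isometry (reflectIso u)) (1 / 2) ⟨one_half_pos, one_half_lt_one⟩
  rwa [asplund_homothety_half hf hu, hO f hf, mean_half_self _ (hpos f hf)] at h

theorem SupConvConcave.le_hypoMinkSym (hF : SupConvConcave α F) (hpos : PosOn α F)
    (hO : OrthInvariant α F) (hf : MemC α f) (hu : ‖u‖ = 1) : F f ≤ F (hypoMinkSym α u f) := by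
  have h := hF f _ hf (hf.comp_isometry (reflectIso u)) (1 / 2) ⟨one_half_pos, one_half_lt_one⟩
  rwa [asplund_homothety_half hf hu, hO f hf, mean_half_self _ (hpos f hf)] at h

theorem ofBase_iterSym_le {β : Type*} [Preorder β] {F : (E n → ℝ) → β}
    (hF : ∀ f, MemC α f → ∀ u, ‖u‖ = 1 → F (hypoMinkSym α u f) ≤ F f) (hf : MemC α f)
    (hus : ∀ i, ‖us i‖ = 1) (m : ℕ) : F (ofBase α (iterSym us (base α f) m)) ≤ F f := by
  obtain ⟨c, hc⟩ := hf.exists_memBase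
  induction m with
  | zero => exact (congrArg F (ofBase_base hf.nonneg)).le
  | succ m ih =>
    have hm := hc.iterSym hus m
    have h := hF _ hm.memC (us m) (hus m)
    rw [hypoMinkSym, hm.base_ofBase] at h
    exact h.trans ih

namespace IsHypoSymmetrization

protected theorem memC (hg : IsHypoSymmetrization α f g) (hf : MemC α f) : MemC α g := by
  obtain ⟨φ, ⟨hφ, -, us, hus, hlim⟩, rfl⟩ := hg
  obtain ⟨c, hc⟩ := hf.exists_memBase
  exact (hc.of_epiTendsto hus hφ hlim).memC

theorem exists_hypoTendsto (hg : IsHypoSymmetrization α f g) (hf : MemC α f) :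
    ∃ us : ℕ → E n, (∀ i, ‖us i‖ = 1) ∧ (∀ m, MemC α (ofBase α (iterSym us (base α f) m))) ∧
      HypoTendsto (fun m => ofBase α (iterSym us (base α f) m)) g := by
  obtain ⟨φ, ⟨hφ, -, us, hus, hlim⟩, rfl⟩ := hg
  obtain ⟨c, hc⟩ := hf.exists_memBase
  have hm := hc.iterSym hus
  exact ⟨us, hus, fun m => (hm m).memC, .of_epiTendsto hm (hc.of_epiTendsto hus hφ hlim) hlim⟩

theorem le (hg : IsHypoSymmetrization α f g) (hf : MemC α f) (hlsc : HypoLSC α F)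
    (hF : ∀ f, MemC α f → ∀ u, ‖u‖ = 1 → F (hypoMinkSym α u f) ≤ F f) : F g ≤ F f := by
  obtain ⟨us, hus, hmem, hlim⟩ := hg.exists_hypoTendsto hf
  refine EReal.coe_le_coe_iff.1 ((hlsc _ g hmem (hg.memC hf) hlim).trans ?_)
  exact liminf_le_of_frequently_le (.of_forall fun m =>
    EReal.coe_le_coe_iff.2 (ofBase_iterSym_le hF hf hus m))

theorem ge (hg : IsHypoSymmetrization α f g) (hf : MemC α f) (husc : HypoUSC α F)
    (hF : ∀ f, MemC α f → ∀ u, ‖u‖ = 1 → F f ≤ F (hypoMinkSym α u f)) : F f ≤ F g := by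
  obtain ⟨us, hus, hmem, hlim⟩ := hg.exists_hypoTendsto hf
  refine EReal.coe_le_coe_iff.1 (le_trans ?_ (husc _ g hmem (hg.memC hf) hlim))
  exact le_limsup_of_frequently_le (.of_forall fun m =>
    EReal.coe_le_coe_iff.2 (ofBase_iterSym_le (F := OrderDual.toDual ∘ F) hF hf hus m))

end IsHypoSymmetrization

end Symmetrization

end HypoSym

open HypoSym in
theorem theorem6p1_general (n : ℕ) (hn : 1 ≤ n) (α : ℝ) :
    (∀ f : E n → ℝ, MemC α f → ∃ g : E n → ℝ, IsHypoSymmetrization α f g) ∧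
    (∀ f g : E n → ℝ, MemC α f → IsHypoSymmetrization α f g → MemC α g) ∧
    (∀ F : (E n → ℝ) → ℝ, PosOn α F → HypoLSC α F → OrthInvariant α F → SupConvConvex α F →
      ∀ f g : E n → ℝ, MemC α f → IsHypoSymmetrization α f g → F f ≥ F g) ∧
    (∀ F : (E n → ℝ) → ℝ, PosOn α F → HypoUSC α F → OrthInvariant α F → SupConvConcave α F →
      ∀ f g : E n → ℝ, MemC α f → IsHypoSymmetrization α f g → F f ≤ F g) := by
  refine ⟨fun f hf => ?_, fun f g hf hg => hg.memC hf,
    fun F hpos hlsc hO hF f g hf hg =>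
      hg.le hf hlsc fun f hf u hu => hF.hypoMinkSym_le hpos hO hf hu,
    fun F hpos husc hO hF f g hf hg =>
      hg.ge hf husc fun f hf u hu => hF.le_hypoMinkSym hpos hO hf hu⟩
  obtain ⟨φ, hφ⟩ := hf.memConvC_base.exists_isEpiSymmetrization hn
  exact ⟨ofBase α φ, φ, hφ, rfl⟩

open HypoSym in
theorem theorem6p1 (n : ℕ) (hn : 1 ≤ n) (α : ℝ) (hα : -1 / (n : ℝ) ≤ α) :
    (∀ f : E n → ℝ, MemC α f → ∃ g : E n → ℝ, IsHypoSymmetrization α f g) ∧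
    (∀ f g : E n → ℝ, MemC α f → IsHypoSymmetrization α f g → MemC α g) ∧
    (∀ F : (E n → ℝ) → ℝ, PosOn α F → HypoLSC α F → OrthInvariant α F → SupConvConvex α F →
      ∀ f g : E n → ℝ, MemC α f → IsHypoSymmetrization α f g → F f ≥ F g) ∧
    (∀ F : (E n → ℝ) → ℝ, PosOn α F → HypoUSC α F → OrthInvariant α F → SupConvConcave α F →
      ∀ f g : E n → ℝ, MemC α f → IsHypoSymmetrization α f g → F f ≤ F g) := by
  exact theorem6p1_general n hn α

end
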